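/- Let $N,k\ge 1$ be integers and let $2^*=2N/(N-2)$ if $N\ge 3$, $2^*=\infty$ if $N\le 2$. Let $m_1,\dots,m_k>0$ and let $F\in C^1(\mathbb R^k,\mathbb R)$ be written as $$F(u)=\tfrac12\sum_{i=1}^k m_i^2|u_i|^2+R(u),\qquad R(0)=0 .$$ Assume that there are constants $c,c'\ge 0$ and exponents $2<p\le q<2^*$ such that $$|\nabla R(u)|\le c\,|u|^{p-1}+c'\,|u|^{q-1}\qquad\text{for all }u\in\mathbb R^k .$$ Let $H^1=H^1(\mathbb R^N,\mathbb R^k)$ be the space of functions $u=(u_1,\dots,u_k)$ all of whose components $u_i$ and weak partial derivatives $\partial_j u_i$ lie in $L^2(\mathbb R^N)$, with norm $\|u\|^2=\sum_i(\|u_i\|_{L^2}^2+\|\nabla u_i\|_{L^2}^2)$. Then $F\circ u\in L^1(\mathbb R^N)$ for every $u\in H^1$, and the Nemytski operator $T_F\colon H^1\to L^1(\mathbb R^N)$, $T_F(u)=F\circ u$, is continuous and is (Fréchet) differentiable at every point. Consequently the functional $$E(u,\omega)=\int_{\mathbb R^N}F(u)\,dx+\frac12\sum_{i=1}^k\|\nabla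 u_i\|_{L^2}^2+\frac12\sum_{i=1}^k\omega_i^2\|u_i\|_{L^2}^2$$ is (Fréchet) differentiable at every point of $H^1\times\mathbb R^k$. -/

import Mathlib

open MeasureTheory
open scoped ContDiff

noncomputable section

namespace EllipticSystem

/-- `ℝ^N` with its Euclidean norm and Lebesgue measure `volume`. -/
abbrev Eucl (N : ℕ) : Type := EuclideanSpace ℝ (Fin N)

/-- The real space `L²(ℝ^N)`. -/
abbrev L2 (N : ℕ) : Type := Lp ℝ 2 (volume : Measure (Eucl N))

/-- `g` is the weak partial derivative `∂_j u` of `u` on `ℝ^N`, tested against `C_c^∞`. -/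
def IsWeakPartialDeriv {N : ℕ} (j : Fin N) (u g : L2 N) : Prop :=
  ∀ φ : Eucl N → ℝ, ContDiff ℝ ∞ φ → HasCompactSupport φ →
    ∫ x, u x * fderiv ℝ φ x (EuclideanSpace.single j 1) = - ∫ x, g x * φ x

lemma integrable_mul_of_hasCompactSupport {N : ℕ} (u : L2 N) {ψ : Eucl N → ℝ}
    (hψ : Continuous ψ) (hc : HasCompactSupport ψ) : Integrable (fun x => u x * ψ x) :=
  (Lp.memLp u).integrable_mul (q := 2) (hψ.memLp_of_hasCompactSupport hc)

lemma integrable_mul_fderiv {N : ℕ} (j : Fin N) (u : L2 N) {φ : Eucl N → ℝ}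
    (hφ : ContDiff ℝ ∞ φ) (hc : HasCompactSupport φ) :
    Integrable (fun x => u x * fderiv ℝ φ x (EuclideanSpace.single j 1)) :=
  integrable_mul_of_hasCompactSupport u
    ((hφ.continuous_fderiv (by simp)).clm_apply continuous_const)
    (hc.fderiv_apply (𝕜 := ℝ) _)

lemma IsWeakPartialDeriv.zero {N : ℕ} (j : Fin N) : IsWeakPartialDeriv j (0 : L2 N) 0 := by
  intro φ _ _
  have h : ∀ ψ : Eucl N → ℝ, ∫ x, (0 : L2 N) x * ψ x = 0 := by
    intro ψ
    rw [integral_eq_zero_of_ae]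
    filter_upwards [Lp.coeFn_zero ℝ 2 (volume : Measure (Eucl N))] with x hx
    simp only [hx, Pi.zero_apply, zero_mul]
  rw [h, h, neg_zero]

lemma IsWeakPartialDeriv.add {N : ℕ} {j : Fin N} {u v g h : L2 N}
    (hu : IsWeakPartialDeriv j u g) (hv : IsWeakPartialDeriv j v h) :
    IsWeakPartialDeriv j (u + v) (g + h) := by
  intro φ hφ hc
  have key : ∀ (a b : L2 N) (ψ : Eucl N → ℝ), Integrable (fun x => a x * ψ x) →
      Integrable (fun x => b x * ψ x) →
      ∫ x, (a + b : L2 N) x * ψ x = (∫ x, a x * ψ x) + ∫ x, b x * ψ x := by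
    intro a b ψ ha hb
    rw [← integral_add ha hb]
    refine integral_congr_ae ?_
    filter_upwards [Lp.coeFn_add a b] with x hx
    rw [hx, Pi.add_apply, add_mul]
  rw [key u v _ (integrable_mul_fderiv j u hφ hc) (integrable_mul_fderiv j v hφ hc),
    key g h _ (integrable_mul_of_hasCompactSupport g hφ.continuous hc)
      (integrable_mul_of_hasCompactSupport h hφ.continuous hc), hu φ hφ hc, hv φ hφ hc]
  ring

lemma IsWeakPartialDeriv.smul {N : ℕ} {j : Fin N} {u g : L2 N} (c : ℝ)
    (hu : IsWeakPartialDeriv j u g) : IsWeakPartialDeriv j (c • u) (c • g) := by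
  intro φ hφ hc
  have key : ∀ (a : L2 N) (ψ : Eucl N → ℝ),
      ∫ x, (c • a : L2 N) x * ψ x = c * ∫ x, a x * ψ x := by
    intro a ψ
    rw [← integral_const_mul]
    refine integral_congr_ae ?_
    filter_upwards [Lp.coeFn_smul c a] with x hx
    rw [hx, Pi.smul_apply, smul_eq_mul, mul_assoc]
  rw [key, key, hu φ hφ hc]
  ring

/-- The scalar Sobolev space `H¹(ℝ^N)`, realised as the space of pairs `(u, ∇u)` where `u ∈ L²`
has weak gradient `∇u = (∂₁u, …, ∂_N u) ∈ (L²)^N`; the inherited norm is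
`‖u‖² = ‖u‖²_{L²} + ∑_j ‖∂_j u‖²_{L²}`. -/
def sobolevH1 (N : ℕ) : Submodule ℝ (WithLp 2 (L2 N × PiLp 2 (fun _ : Fin N => L2 N))) where
  carrier := {w | ∀ j, IsWeakPartialDeriv j w.fst (w.snd j)}
  zero_mem' := fun j => IsWeakPartialDeriv.zero j
  add_mem' := fun ha hb j => (ha j).add (hb j)
  smul_mem' := fun c _ ha j => (ha j).smul c

/-- `H¹(ℝ^N, ℝ^k)`: the `k`-tuples of elements of `H¹(ℝ^N)`, with
`‖u‖² = ∑_i (‖u_i‖²_{L²} + ‖∇u_i‖²_{L²})`. -/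
abbrev H1 (N k : ℕ) : Type := PiLp 2 (fun _ : Fin k => sobolevH1 N)

/-- The `i`-th component `u_i ∈ L²(ℝ^N)` of `u`. -/
def H1.comp {N k : ℕ} (u : H1 N k) (i : Fin k) : L2 N := (u i).val.fst

/-- The weak gradient `∇u_i ∈ L²(ℝ^N)^N` of the `i`-th component of `u`. -/
def H1.grad {N k : ℕ} (u : H1 N k) (i : Fin k) : PiLp 2 (fun _ : Fin N => L2 N) :=
  (u i).val.snd

/-- The function `x ↦ u(x) = (u_1(x), …, u_k(x))` from `ℝ^N` to `ℝ^k`. -/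
def H1.toFun {N k : ℕ} (u : H1 N k) (x : Eucl N) : Eucl k :=
  WithLp.toLp 2 (fun i => u.comp i x)

/-- The critical Sobolev exponent: `2* = 2N/(N-2)` for `N ≥ 3`, and `2* = ∞` for `N ≤ 2`. -/
def criticalExponent (N : ℕ) : EReal :=
  if N ≤ 2 then ⊤ else ((2 * (N : ℝ) / ((N : ℝ) - 2) : ℝ) : EReal)

/-- The Nemytski operator `T_F : H¹ → L¹`, `u ↦ F ∘ u`, given that `F ∘ u` is always integrable. -/
def nemytski {N k : ℕ} (F : Eucl k → ℝ)
    (hF : ∀ u : H1 N k, Integrable (fun x => F (u.toFun x)) volume) (u : H1 N k) :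
    Lp ℝ 1 (volume : Measure (Eucl N)) :=
  (hF u).toL1 (fun x => F (u.toFun x))

/-- The energy `E(u, ω) = ∫ F(u) + ½ ∑_i ‖∇u_i‖²_{L²} + ½ ∑_i ω_i² ‖u_i‖²_{L²}`. -/
def energy {N k : ℕ} (F : Eucl k → ℝ) (z : H1 N k × Eucl k) : ℝ :=
  (∫ x, F (z.1.toFun x)) + 1 / 2 * ∑ i, ‖z.1.grad i‖ ^ 2
    + 1 / 2 * ∑ i, z.2 i ^ 2 * ‖z.1.comp i‖ ^ 2

end EllipticSystem

end

noncomputable section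

namespace EllipticSystem

open scoped ENNReal NNReal Topology
open Filter

/-! The proof fixes one exponent `r ≥ q` for which `H¹` embeds in `L^r`. Since powers between `1`
and `r - 1` are dominated by `t + t ^ (r - 1)`, all hypotheses on `R` collapse to `|F'(v)| ≤ K (|v|
+ |v|^(r-1))`, and only the spaces `L²` and `L^r` matter from then on.

Embedding. For `N ≥ 3` the Sobolev inequality gives `r = 2*`. For `N ≤ 2` an inequality with the
`L¹` norm of the gradient is applied to powers of `f`, which bounds `‖f^(n+2)‖₂` by `‖f^(n+1)‖₂
‖∇f‖₂` and, by induction, reaches every exponent `2(n+1)`. Mollification and cutoff give test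
functions bounded in `H¹` and converging a.e.; Fatou carries the inequality over, so norm density is
never needed (`HasTestEmbedding.exists_eLpNorm_fst_le`).

Differentiability. Let `ρ = |F(u+h) - F(u) - F'(u)h| / |h|`. The growth bound gives `ρ ≤ L|u| +
L|u|^(r-1) + L(|h| + |h|^(r-1))`. If `h → 0` in `H¹`, then along a subsequence `h → 0` and `ρ → 0`
a.e. Truncating `ρ` at each of the first two terms leaves factors that tend to zero in the dual
exponent by dominated convergence, and Hölder turns them into `o(1)‖h‖`. The last term integrates to
`‖h‖₂² + ‖h‖_r^r`, which is also `o(‖h‖)`. This is `exists_lintegral_remainder_le`;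
`hasFDerivAt_of_seq` shows that subsequences suffice. Continuity follows from differentiability. The
energy adds to a bounded functional of `T_F` only squared Hilbert norms of bounded linear maps, with
polynomial coefficients in `ω`. -/

/-! ### Sobolev inequalities for test functions. -/

/-- The `L²` norm of `f ^ (n + 1)` when a gain of one power is controlled. -/
lemma eLpNorm_pow_le_of_step {α : Type*} [MeasurableSpace α] {μ : Measure α} {f : α → ℝ}
    {M C : ℝ≥0} (h0 : eLpNorm f 2 μ ≤ M)
    (hstep : ∀ n : ℕ, eLpNorm (fun x => f x ^ (n + 2)) 2 μ
      ≤ C * (n + 2 : ℕ) * M * eLpNorm (fun x => f x ^ (n + 1)) 2 μ) (n : ℕ) :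
    eLpNorm (fun x => f x ^ (n + 1)) 2 μ ≤ C ^ n * (n + 1).factorial * M ^ (n + 1) := by
  induction n with
  | zero => simpa using h0
  | succ n ih =>
    refine (hstep n).trans ((mul_le_mul_right ih _).trans_eq ?_)
    rw [Nat.factorial_succ (n + 1)]
    push_cast
    ring

/-- The hypothesis bounds the `(n+1)`-th power of the `L^(2(n+1))` norm. Taking roots would leave
`C^(1/(n+1))`, which `1 ≤ C` allows to be replaced by `C`. -/
lemma eLpNorm_le_of_eLpNorm_pow_le {α : Type*} [MeasurableSpace α] {μ : Measure α} {f : α → ℝ}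
    {n : ℕ} {M C : ℝ≥0} (hC : 1 ≤ C)
    (h : eLpNorm (fun x => f x ^ (n + 1)) 2 μ ≤ C * M ^ (n + 1)) :
    eLpNorm f (ENNReal.ofReal (2 * (n + 1))) μ ≤ C * M := by
  have hn : (0 : ℝ) < n + 1 := by positivity
  have key : eLpNorm (fun x => f x ^ (n + 1)) 2 μ
      = eLpNorm f (ENNReal.ofReal (2 * (n + 1))) μ ^ (n + 1) := by
    have h1 : (fun x => ‖f x ^ (n + 1)‖) = fun x => ‖f x‖ ^ ((n : ℝ) + 1) := by
      ext x
      rw [norm_pow, ← Real.rpow_natCast]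
      push_cast
      rfl
    rw [← eLpNorm_norm, h1, eLpNorm_norm_rpow _ hn, ← ENNReal.rpow_natCast]
    rw [ENNReal.ofReal_mul (by norm_num)]
    push_cast
    simp
  rw [key] at h
  have h2 : (C : ℝ≥0∞) * (M : ℝ≥0∞) ^ (n + 1) ≤ ((C : ℝ≥0∞) * M) ^ (n + 1) := by
    rw [mul_pow]
    gcongr
    exact le_self_pow₀ (by exact_mod_cast hC) (by simp)
  exact (ENNReal.pow_le_pow_left_iff (by simp)).1 (h.trans h2)

lemma fderiv_pow_enorm_le {N : ℕ} {f : Eucl N → ℝ} (hf : ContDiff ℝ 1 f) (n : ℕ) (x : Eucl N) :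
    ‖fderiv ℝ (fun y => f y ^ (n + 2)) x‖ₑ ≤ (n + 2 : ℕ) * (‖f x ^ (n + 1)‖ₑ * ‖fderiv ℝ f x‖ₑ) := by
  have hd : HasFDerivAt (fun y => f y ^ (n + 2)) _ x :=
    (hf.differentiable one_ne_zero x).hasFDerivAt.pow (n + 2)
  rw [hd.fderiv, ← mul_assoc, enorm_smul, nsmul_eq_mul, enorm_mul,
    show n + 2 - 1 = n + 1 from rfl, show ‖((n + 2 : ℕ) : ℝ)‖ₑ = (n + 2 : ℕ) by
      rw [← ofReal_norm, Real.norm_natCast, ENNReal.ofReal_natCast]]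

/-- The embedding inequality for test functions. -/
def HasTestEmbedding (N : ℕ) (r : ℝ) : Prop :=
  ∃ C : ℝ≥0, ∀ f : Eucl N → ℝ, ContDiff ℝ 1 f → HasCompactSupport f → ∀ M : ℝ≥0,
    eLpNorm f 2 volume ≤ M → eLpNorm (fderiv ℝ f) 2 volume ≤ M →
      eLpNorm f (ENNReal.ofReal r) volume ≤ C * M

lemma hasTestEmbedding_of_step {N : ℕ} {C : ℝ≥0}
    (hstep : ∀ f : Eucl N → ℝ, ContDiff ℝ 1 f → HasCompactSupport f → ∀ M : ℝ≥0,
      eLpNorm f 2 volume ≤ M → eLpNorm (fderiv ℝ f) 2 volume ≤ M → ∀ n : ℕ,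
      eLpNorm (fun x => f x ^ (n + 2)) 2 volume
        ≤ C * (n + 2 : ℕ) * M * eLpNorm (fun x => f x ^ (n + 1)) 2 volume) (n : ℕ) :
    HasTestEmbedding N (2 * (n + 1)) := by
  refine ⟨max 1 (C ^ n * (n + 1).factorial), fun f hf hc M h1 h2 => ?_⟩
  refine eLpNorm_le_of_eLpNorm_pow_le (le_max_left _ _) ?_
  refine (eLpNorm_pow_le_of_step h1 (hstep f hf hc M h1 h2) n).trans ?_
  gcongr
  exact_mod_cast le_max_right (1 : ℝ≥0) (C ^ n * (n + 1).factorial)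

/-- Chain rule and Cauchy–Schwarz: this is what gains one power of `f` at the price of one factor
`M`. -/
lemma eLpNorm_one_fderiv_pow_le {N : ℕ} {f : Eucl N → ℝ} (hf : ContDiff ℝ 1 f) {M : ℝ≥0}
    (h : eLpNorm (fderiv ℝ f) 2 volume ≤ M) (n : ℕ) :
    eLpNorm (fderiv ℝ (fun y => f y ^ (n + 2))) 1 volume
      ≤ (n + 2 : ℕ) * M * eLpNorm (fun x => f x ^ (n + 1)) 2 volume := by
  have hd : Continuous (fderiv ℝ f) := hf.continuous_fderiv one_ne_zero
  calc eLpNorm (fderiv ℝ (fun y => f y ^ (n + 2))) 1 volume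
      ≤ ∫⁻ x, (n + 2 : ℕ) * (‖f x ^ (n + 1)‖ₑ * ‖fderiv ℝ f x‖ₑ) := by
        rw [eLpNorm_one_eq_lintegral_enorm]
        exact lintegral_mono (fderiv_pow_enorm_le hf n)
    _ = (n + 2 : ℕ) * ∫⁻ x, ‖f x ^ (n + 1)‖ₑ * ‖fderiv ℝ f x‖ₑ :=
        lintegral_const_mul' _ _ (by simp)
    _ ≤ (n + 2 : ℕ) * (eLpNorm (fun x => f x ^ (n + 1)) 2 volume
          * eLpNorm (fderiv ℝ f) 2 volume) := by
        gcongr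
        have := ENNReal.lintegral_mul_le_Lp_mul_Lq (volume : Measure (Eucl N))
          Real.HolderConjugate.two_two
          (f := fun x => ‖f x ^ (n + 1)‖ₑ) (g := fun x => ‖fderiv ℝ f x‖ₑ)
          (hf.continuous.pow _).enorm.measurable.aemeasurable hd.enorm.measurable.aemeasurable
        simpa [eLpNorm_eq_lintegral_rpow_enorm_toReal] using this
    _ ≤ _ := by
        rw [mul_assoc, mul_comm (M : ℝ≥0∞)]
        gcongr

/-- In the plane the Gagliardo–Nirenberg inequality sends an `L¹` gradient to `L²`, because the
dimension `2` is its own conjugate exponent. Applied to `f ^ (n + 2)` it gives the step. -/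
lemma hasTestEmbedding_two (n : ℕ) : HasTestEmbedding 2 (2 * (n + 1)) := by
  refine hasTestEmbedding_of_step
    (C := eLpNormLESNormFDerivOneConst (volume : Measure (Eucl 2)) (2 : ℝ≥0)) ?_ n
  intro f hf hc M _ h2 n
  have hcp : HasCompactSupport (fun x => f x ^ (n + 2)) :=
    hc.comp_left (g := fun t : ℝ => t ^ (n + 2)) (by simp)
  have := eLpNorm_le_eLpNorm_fderiv_one (volume : Measure (Eucl 2)) (hf.pow (n + 2)) hcp (p := 2)
    (by simpa using NNReal.HolderConjugate.two_two)
  refine (this.trans (mul_le_mul_right (eLpNorm_one_fderiv_pow_le hf h2 n) _)).trans_eq ?_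
  ring

/-- The fundamental theorem of calculus on a half-line, carried over by a linear isometry between
`ℝ` and `Eucl 1`. -/
lemma enorm_le_eLpNorm_one_fderiv {f : Eucl 1 → ℝ} (hf : ContDiff ℝ 1 f)
    (hc : HasCompactSupport f) (x : Eucl 1) : ‖f x‖ₑ ≤ eLpNorm (fderiv ℝ f) 1 volume := by
  let b : OrthonormalBasis (Fin 1) ℝ ℝ := OrthonormalBasis.singleton (Fin 1) ℝ
  let e : ℝ ≃ₗᵢ[ℝ] Eucl 1 := b.repr
  have hg : ContDiff ℝ 1 (f ∘ e) := hf.comp e.contDiff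
  have hgc : HasCompactSupport (f ∘ e) := hc.comp_homeomorph e.toHomeomorph
  obtain ⟨t, rfl⟩ := e.surjective x
  calc ‖f (e t)‖ₑ ≤ ∫⁻ s in Set.Iic t, ‖deriv (f ∘ e) s‖ₑ :=
        HasCompactSupport.enorm_le_lintegral_Ici_deriv hg hgc t
    _ ≤ ∫⁻ s, ‖deriv (f ∘ e) s‖ₑ := setLIntegral_le_lintegral _ _
    _ ≤ ∫⁻ s, ‖fderiv ℝ f (e s)‖ₑ := by
        refine lintegral_mono fun s => ?_
        have h1 : HasDerivAt (f ∘ e) (fderiv ℝ f (e s) (e 1)) s := by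
          refine (hf.differentiable one_ne_zero (e s)).hasFDerivAt.comp_hasDerivAt s ?_
          simpa using (e.toContinuousLinearEquiv.hasFDerivAt (x := s)).hasDerivAt
        rw [h1.deriv]
        refine (ContinuousLinearMap.le_opENorm _ _).trans ?_
        simp
    _ = ∫⁻ y, ‖fderiv ℝ f y‖ₑ :=
        e.measurePreserving.lintegral_comp
          (hf.continuous_fderiv one_ne_zero).enorm.measurable
    _ = _ := eLpNorm_one_eq_lintegral_enorm.symm

lemma hasTestEmbedding_one (n : ℕ) : HasTestEmbedding 1 (2 * (n + 1)) := by
  refine hasTestEmbedding_of_step (C := 1) ?_ n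
  intro f hf hc M h1 h2 n
  -- The sup bound for `f ^ 2` gives `|f|² ≤ 2M‖f‖₂ ≤ (2M)²`. One factor of `f` can then be pulled
  -- out of `‖f^(n+2)‖₂`, and `2 ≤ n + 2` gives the step with `C = 1`.
  have hsup : ∀ x, ‖f x‖ₑ ≤ 2 * M := by
    intro x
    have h := (enorm_le_eLpNorm_one_fderiv (hf.pow 2)
      (hc.comp_left (g := fun t : ℝ => t ^ 2) (by simp)) x).trans
      (eLpNorm_one_fderiv_pow_le hf h2 0)
    refine (ENNReal.pow_le_pow_left_iff two_ne_zero).1 ?_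
    calc ‖f x‖ₑ ^ 2 = ‖f x ^ 2‖ₑ := (enorm_pow _ _).symm
      _ ≤ 2 * M * eLpNorm f 2 volume := by simpa using h
      _ ≤ 2 * M * (2 * M) := by
        gcongr
        refine h1.trans ?_
        rw [two_mul]
        exact le_self_add
      _ = _ := (sq _).symm
  have h3 : eLpNorm (fun x => f x ^ (n + 2)) 2 volume
      ≤ eLpNorm ((((2 * M : ℝ≥0) : ℝ)) • fun x => f x ^ (n + 1)) 2 volume := by
    refine eLpNorm_mono_enorm fun x => ?_
    have h4 : ‖((2 * M : ℝ≥0) : ℝ)‖ₑ = 2 * M := by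
      rw [Real.enorm_eq_ofReal (by positivity), ENNReal.ofReal_coe_nnreal]
      push_cast
      rfl
    rw [Pi.smul_apply, enorm_smul, h4, pow_succ, enorm_mul, mul_comm]
    gcongr
    exact hsup x
  refine h3.trans ((eLpNorm_const_smul_le).trans ?_)
  rw [Real.enorm_eq_ofReal (by positivity), ENNReal.ofReal_coe_nnreal]
  push_cast
  gcongr
  rw [one_mul]
  exact le_add_self

lemma hasTestEmbedding_of_three_le {N : ℕ} (hN : 3 ≤ N) :
    HasTestEmbedding N (2 * N / (N - 2)) := by
  have hN' : (3 : ℝ) ≤ N := by exact_mod_cast hN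
  have hr : (0 : ℝ) ≤ 2 * N / (N - 2) := div_nonneg (by positivity) (by linarith)
  refine ⟨SNormLESNormFDerivOfEqConst ℝ (volume : Measure (Eucl N)) (2 : ℝ≥0),
    fun f hf hc M _ h2 => ?_⟩
  have := eLpNorm_le_eLpNorm_fderiv_of_eq (volume : Measure (Eucl N)) hf hc
    (p := 2) (p' := (2 * N / (N - 2) : ℝ).toNNReal) (by norm_num) (by simp; omega) (by
      rw [Real.coe_toNNReal _ hr]
      have : (N : ℝ) - 2 ≠ 0 := by linarith
      simp
      field_simp)
  exact this.trans (by gcongr; exact_mod_cast h2)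

/-- Above every subcritical exponent there is one for which the embedding holds. -/
lemma exists_hasTestEmbedding {N : ℕ} (hN : 1 ≤ N) {q : ℝ}
    (hq : (q : EReal) < criticalExponent N) : ∃ r, q ≤ r ∧ HasTestEmbedding N r := by
  obtain ⟨n, hn⟩ := exists_nat_ge q
  have hn' : q ≤ 2 * (n + 1) := by linarith [(Nat.cast_nonneg n : (0 : ℝ) ≤ n)]
  rcases le_or_gt N 2 with h | h
  · interval_cases N
    · exact ⟨_, hn', hasTestEmbedding_one n⟩
    · exact ⟨_, hn', hasTestEmbedding_two n⟩
  -- For `N ≥ 3` the critical exponent itself is used, so no interpolation is required.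
  · rw [criticalExponent, if_neg (by omega)] at hq
    exact ⟨_, (EReal.coe_lt_coe_iff.1 hq).le, hasTestEmbedding_of_three_le h⟩

/-! ### From test functions to `H¹`: mollification, cutoff and Fatou. -/

section Embedding

open scoped Convolution
open ContinuousLinearMap

/-- Young's inequality `L¹ * L² ⊆ L²` for a kernel of mass one. -/
lemma eLpNorm_convolution_le {N : ℕ} {ψ : Eucl N → ℝ} (hψ : Continuous ψ)
    (hψ0 : ∀ x, 0 ≤ ψ x) (hψ1 : ∫ x, ψ x = 1) (g : L2 N) :
    eLpNorm (ψ ⋆[lsmul ℝ ℝ, volume] g) 2 volume ≤ eLpNorm g 2 volume := by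
  have hmass : ∫⁻ x, ‖ψ x‖ₑ = 1 := by
    have hi : Integrable ψ := by
      by_contra h
      rw [integral_undef h] at hψ1
      exact zero_ne_one hψ1
    rw [← ofReal_integral_norm_eq_lintegral_enorm hi]
    simp [Real.norm_of_nonneg (hψ0 _), hψ1]
  have hgm : AEMeasurable (fun y => ‖g y‖ₑ) volume := (Lp.aestronglyMeasurable g).enorm
  have hpt : ∀ x, ‖(ψ ⋆[lsmul ℝ ℝ, volume] g) x‖ₑ ^ 2 ≤ ∫⁻ y, ‖ψ (x - y)‖ₑ * ‖g y‖ₑ ^ 2 := by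
    intro x
    have hm : AEMeasurable (fun y => ‖ψ (x - y)‖ₑ) (volume : Measure (Eucl N)) := by fun_prop
    have h1 : ∫⁻ y, ‖ψ (x - y)‖ₑ = 1 := by
      rw [← hmass]
      exact lintegral_sub_left_eq_self (fun y => ‖ψ y‖ₑ) x
    -- Writing `ψ = ψ^(1/2) ψ^(1/2)` makes this Cauchy–Schwarz for the probability measure `ψ(x - y)
    -- dy`; integrating the resulting pointwise bound by Tonelli finishes the proof.
    have hCS := ENNReal.lintegral_mul_le_Lp_mul_Lq (volume : Measure (Eucl N))
      Real.HolderConjugate.two_two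
      (f := fun y => ‖ψ (x - y)‖ₑ ^ (1 / 2 : ℝ)) (g := fun y => ‖ψ (x - y)‖ₑ ^ (1 / 2 : ℝ) * ‖g y‖ₑ)
      (hm.pow_const _) ((hm.pow_const _).mul hgm)
    have hhalf : ∀ a : ℝ≥0∞, a ^ (1 / 2 : ℝ) * a ^ (1 / 2 : ℝ) = a := fun a => by
      rw [← ENNReal.rpow_add_of_nonneg _ _ (by norm_num) (by norm_num)]
      norm_num
    have hhalf2 : ∀ a : ℝ≥0∞, (a ^ (1 / 2 : ℝ)) ^ (2 : ℝ) = a := fun a => by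
      rw [← ENNReal.rpow_mul]
      norm_num
    simp only [Pi.mul_apply, ← mul_assoc, hhalf, ENNReal.mul_rpow_of_nonneg _ _ (zero_le_two (α := ℝ)),
      hhalf2, h1, ENNReal.one_rpow, one_mul] at hCS
    have h2 : ‖(ψ ⋆[lsmul ℝ ℝ, volume] g) x‖ₑ ≤ ∫⁻ y, ‖ψ (x - y)‖ₑ * ‖g y‖ₑ := by
      rw [convolution_lsmul_swap]
      refine (enorm_integral_le_lintegral_enorm _).trans_eq ?_
      simp_rw [enorm_smul]
    calc ‖(ψ ⋆[lsmul ℝ ℝ, volume] g) x‖ₑ ^ 2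
        ≤ ((∫⁻ y, ‖ψ (x - y)‖ₑ * ‖g y‖ₑ ^ (2 : ℝ)) ^ (1 / 2 : ℝ)) ^ 2 := by
          gcongr
          exact h2.trans hCS
      _ = _ := by
          rw [← ENNReal.rpow_two, hhalf2]
          simp_rw [ENNReal.rpow_two]
  have hsq : ∀ f : Eucl N → ℝ, eLpNorm f 2 volume ^ 2 = ∫⁻ x, ‖f x‖ₑ ^ 2 := by
    intro f
    have := eLpNorm_nnreal_pow_eq_lintegral (f := f) (μ := volume) (p := 2) two_ne_zero
    simpa using this
  refine (ENNReal.pow_le_pow_left_iff two_ne_zero).1 ?_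
  rw [hsq, hsq]
  calc ∫⁻ x, ‖(ψ ⋆[lsmul ℝ ℝ, volume] g) x‖ₑ ^ 2
      ≤ ∫⁻ x, ∫⁻ y, ‖ψ (x - y)‖ₑ * ‖g y‖ₑ ^ 2 := lintegral_mono hpt
    _ = ∫⁻ y, ∫⁻ x, ‖ψ (x - y)‖ₑ * ‖g y‖ₑ ^ 2 := by
        refine lintegral_lintegral_swap (AEMeasurable.mul (f := fun z : Eucl N × Eucl N =>
          ‖ψ (z.1 - z.2)‖ₑ) (g := fun z : Eucl N × Eucl N => ‖g z.2‖ₑ ^ 2) ?_ ?_)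
        · exact (hψ.comp (continuous_fst.sub continuous_snd)).enorm.measurable.aemeasurable
        · exact (hgm.comp_quasiMeasurePreserving Measure.quasiMeasurePreserving_snd).pow_const 2
    _ = ∫⁻ y, ‖g y‖ₑ ^ 2 := by
        refine lintegral_congr fun y => ?_
        have hm : Measurable fun x => ‖ψ (x - y)‖ₑ :=
          (hψ.comp (continuous_id.sub continuous_const)).enorm.measurable
        rw [lintegral_mul_const _ hm, lintegral_sub_right_eq_self (fun x => ‖ψ x‖ₑ) y,
          hmass, one_mul]

/-- Mollification commutes with weak derivatives. -/
lemma IsWeakPartialDeriv.fderiv_convolution {N : ℕ} {j : Fin N} {u g : L2 N}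
    (h : IsWeakPartialDeriv j u g) {ψ : Eucl N → ℝ} (hψ : ContDiff ℝ ∞ ψ)
    (hc : HasCompactSupport ψ) (x : Eucl N) :
    fderiv ℝ (ψ ⋆[lsmul ℝ ℝ, volume] u) x (EuclideanSpace.single j 1)
      = (ψ ⋆[lsmul ℝ ℝ, volume] g) x := by
  have hu : LocallyIntegrable u volume := (Lp.memLp u).locallyIntegrable (by norm_num)
  have hd := hc.hasFDerivAt_convolution_left (lsmul ℝ ℝ) (hψ.of_le (by simp)) hu x
  have hex : ConvolutionExistsAt (fderiv ℝ ψ) u x ((lsmul ℝ ℝ).precompL (Eucl N)) volume :=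
    (hc.fderiv ℝ).convolutionExists_left _ (hψ.continuous_fderiv (by simp)) hu x
  rw [hd.fderiv, convolution_eq_swap]
  have hex' := hex.integrable_swap
  rw [ContinuousLinearMap.integral_apply hex']
  -- The reflected kernel is the test function. The sign from differentiating `x - y` cancels the
  -- sign in the definition of the weak derivative.
  have hφ : ContDiff ℝ ∞ (fun y => ψ (x - y)) := hψ.comp (contDiff_const.sub contDiff_id)
  have hφc : HasCompactSupport (fun y => ψ (x - y)) :=
    hc.comp_homeomorph (Homeomorph.subLeft x)
  have key := h _ hφ hφc
  have hfd : ∀ y, fderiv ℝ (fun y => ψ (x - y)) y (EuclideanSpace.single j 1)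
      = - fderiv ℝ ψ (x - y) (EuclideanSpace.single j 1) := by
    intro y
    have := ((hψ.differentiable (by simp) (x - y)).hasFDerivAt).comp y
      ((hasFDerivAt_id y).const_sub x)
    have h2 : HasFDerivAt (fun y => ψ (x - y)) _ y := this
    rw [h2.fderiv]
    simp
  simp_rw [hfd, mul_neg, integral_neg, neg_inj] at key
  rw [convolution_lsmul_swap]
  simp only [smul_eq_mul, mul_comm (ψ _)]
  rw [← key]
  refine integral_congr_ae (Eventually.of_forall fun y => ?_)
  simp [ContinuousLinearMap.precompL_apply, mul_comm]

lemma enorm_le_sum_enorm_apply_single {N : ℕ} (L : Eucl N →L[ℝ] ℝ) :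
    ‖L‖ₑ ≤ ∑ j, ‖L (EuclideanSpace.single j 1)‖ₑ := by
  have h : ‖L‖ ≤ ∑ j, ‖L (EuclideanSpace.single j 1)‖ := by
    refine L.opNorm_le_bound (by positivity) fun v => ?_
    have hv : v = ∑ j, v j • EuclideanSpace.single j (1 : ℝ) := by
      conv_lhs => rw [← (EuclideanSpace.basisFun (Fin N) ℝ).sum_repr v]
      simp
    conv_lhs => rw [hv, map_sum]
    rw [Finset.sum_mul]
    refine (norm_sum_le _ _).trans (Finset.sum_le_sum fun j _ => ?_)
    rw [map_smul, norm_smul, mul_comm]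
    gcongr
    exact PiLp.norm_apply_le v j
  have := ENNReal.ofReal_le_ofReal h
  rw [ENNReal.ofReal_sum_of_nonneg fun _ _ => norm_nonneg _] at this
  simpa only [ofReal_norm] using this

lemma eLpNorm_fderiv_convolution_le {N : ℕ} (w : sobolevH1 N) {ψ : Eucl N → ℝ}
    (hψ : ContDiff ℝ ∞ ψ) (hc : HasCompactSupport ψ)
    (hψ0 : ∀ x, 0 ≤ ψ x) (hψ1 : ∫ x, ψ x = 1) :
    eLpNorm (fderiv ℝ (ψ ⋆[lsmul ℝ ℝ, volume] w.val.fst)) 2 volume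
      ≤ ∑ j, eLpNorm (w.val.snd j) 2 volume := by
  have hcont : ∀ j, Continuous (ψ ⋆[lsmul ℝ ℝ, volume] (w.val.snd j : Eucl N → ℝ)) := fun j =>
    hc.continuous_convolution_left _ hψ.continuous
      ((Lp.memLp (w.val.snd j)).locallyIntegrable (by norm_num))
  calc _ ≤ eLpNorm (∑ j, fun x => ‖(ψ ⋆[lsmul ℝ ℝ, volume] (w.val.snd j : Eucl N → ℝ)) x‖) 2
        volume := by
        refine eLpNorm_mono_enorm fun x => (enorm_le_sum_enorm_apply_single _).trans_eq ?_
        rw [Finset.sum_apply, Real.enorm_of_nonneg (by positivity),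
          ENNReal.ofReal_sum_of_nonneg fun _ _ => norm_nonneg _]
        refine Finset.sum_congr rfl fun j _ => ?_
        rw [(w.property j).fderiv_convolution hψ hc, ofReal_norm]
    _ ≤ ∑ j, eLpNorm (fun x => ‖(ψ ⋆[lsmul ℝ ℝ, volume] (w.val.snd j : Eucl N → ℝ)) x‖) 2
        volume := eLpNorm_sum_le (fun j _ => (hcont j).norm.aestronglyMeasurable) (by norm_num)
    _ ≤ _ := by
        refine Finset.sum_le_sum fun j _ => ?_
        rw [eLpNorm_norm]
        exact eLpNorm_convolution_le hψ.continuous hψ0 hψ1 _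

lemma eLpNorm_fst_le {N : ℕ} (w : sobolevH1 N) : eLpNorm w.val.fst 2 volume ≤ ‖w‖ₑ := by
  have h : ‖w.val.fst‖ ≤ ‖w.val‖ := WithLp.norm_fst_le _ w.val
  rw [← Lp.enorm_def, ← ofReal_norm, ← ofReal_norm]
  exact ENNReal.ofReal_le_ofReal h

lemma eLpNorm_snd_le {N : ℕ} (w : sobolevH1 N) (j : Fin N) :
    eLpNorm (w.val.snd j) 2 volume ≤ ‖w‖ₑ := by
  have h : ‖w.val.snd j‖ ≤ ‖w.val‖ :=
    (PiLp.norm_apply_le w.val.snd j).trans (WithLp.norm_snd_le _ w.val)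
  rw [← Lp.enorm_def, ← ofReal_norm, ← ofReal_norm]
  exact ENNReal.ofReal_le_ofReal h

/-- Cutoff functions `χ n → 1` with values in `[0, 1]` and uniformly bounded derivatives. -/
lemma exists_cutoff (N : ℕ) : ∃ (χ : ℕ → Eucl N → ℝ) (D : ℝ≥0), (∀ n, ContDiff ℝ ∞ (χ n)) ∧
    (∀ n, HasCompactSupport (χ n)) ∧ (∀ n x, ‖χ n x‖ₑ ≤ 1) ∧ (∀ n x, ‖fderiv ℝ (χ n) x‖ₑ ≤ D) ∧
    ∀ x, ∀ᶠ n in atTop, χ n x = 1 := by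
  let b : ContDiffBump (0 : Eucl N) := ⟨1, 2, one_pos, one_lt_two⟩
  have hb : ContDiff ℝ ∞ b := b.contDiff
  obtain ⟨D, hD⟩ := (hb.continuous_fderiv (by simp)).bounded_above_of_compact_support
    (b.hasCompactSupport.fderiv ℝ)
  have hs : ∀ n : ℕ, (0 : ℝ) < ((n : ℝ) + 1)⁻¹ := fun n => by positivity
  -- Dilating a fixed bump multiplies its gradient by `1/(n+1) ≤ 1`, so the bound for `n = 0` serves
  -- for all `n`.
  refine ⟨fun n x => b (((n : ℝ) + 1)⁻¹ • x), D.toNNReal, fun n => hb.comp (contDiff_const_smul _),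
    fun n => b.hasCompactSupport.comp_homeomorph (Homeomorph.smulOfNeZero _ (hs n).ne'),
    fun n x => ?_, fun n x => ?_, fun x => ?_⟩
  · rw [Real.enorm_of_nonneg b.nonneg, ENNReal.ofReal_le_one]
    exact b.le_one
  · have h2 : HasFDerivAt (fun x => b (((n : ℝ) + 1)⁻¹ • x)) _ x :=
      ((hb.differentiable (by simp) _).hasFDerivAt).comp x
        ((hasFDerivAt_id x).const_smul ((n : ℝ) + 1)⁻¹)
    rw [h2.fderiv, ← ofReal_norm]
    refine ENNReal.ofReal_le_ofReal ?_
    rw [ContinuousLinearMap.comp_smul, norm_smul, ContinuousLinearMap.comp_id]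
    refine (mul_le_of_le_one_left (norm_nonneg _) ?_).trans (hD _)
    rw [Real.norm_of_nonneg (hs n).le]
    exact inv_le_one_of_one_le₀ (by linarith [(Nat.cast_nonneg n : (0 : ℝ) ≤ n)])
  · obtain ⟨m, hm⟩ := exists_nat_ge ‖x‖
    filter_upwards [eventually_ge_atTop m] with n hn
    refine b.one_of_mem_closedBall ?_
    rw [mem_closedBall_zero_iff, norm_smul, Real.norm_of_nonneg (hs n).le,
      inv_mul_le_iff₀ (by positivity)]
    have : (m : ℝ) ≤ n := by exact_mod_cast hn
    show ‖x‖ ≤ (n + 1) * 1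
    linarith

/-- Functions in `H¹` are a.e. limits of test functions bounded in `H¹`. -/
lemma exists_testFunction_approx (N : ℕ) : ∃ K : ℝ≥0, ∀ w : sobolevH1 N,
    ∃ f : ℕ → Eucl N → ℝ, (∀ n, ContDiff ℝ 1 (f n)) ∧ (∀ n, HasCompactSupport (f n)) ∧
      (∀ n, eLpNorm (f n) 2 volume ≤ (K * ‖w‖₊ : ℝ≥0)) ∧
      (∀ n, eLpNorm (fderiv ℝ (f n)) 2 volume ≤ (K * ‖w‖₊ : ℝ≥0)) ∧
      ∀ᵐ x, Tendsto (fun n => f n x) atTop (𝓝 (w.val.fst x)) := by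
  obtain ⟨χ, D, hχ, hχc, hχ1, hχD, hχlim⟩ := exists_cutoff N
  -- `1` covers the `L²` norm; in the gradient, `N` counts the partial derivatives of the
  -- mollification and `D` pays for the gradient of the cutoff.
  refine ⟨1 + N + D, fun w => ?_⟩
  have hloc : LocallyIntegrable w.val.fst volume :=
    (Lp.memLp w.val.fst).locallyIntegrable (by norm_num)
  let b : ℕ → ContDiffBump (0 : Eucl N) := fun n =>
    ⟨1 / ((n : ℝ) + 1), 2 * (1 / ((n : ℝ) + 1)), by positivity,
      lt_two_mul_self (by positivity)⟩
  let ψ : ℕ → Eucl N → ℝ := fun n => (b n).normed volume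
  let v : ℕ → Eucl N → ℝ := fun n => ψ n ⋆[lsmul ℝ ℝ, volume] w.val.fst
  have hψ : ∀ n, ContDiff ℝ ∞ (ψ n) := fun n => (b n).contDiff_normed
  have hψc : ∀ n, HasCompactSupport (ψ n) := fun n => (b n).hasCompactSupport_normed
  have hv : ∀ n, ContDiff ℝ 1 (v n) := fun n =>
    (hψc n).contDiff_convolution_left _ ((hψ n).of_le (by simp)) hloc
  have hv2 : ∀ n, eLpNorm (v n) 2 volume ≤ ‖w‖ₑ := fun n =>
    (eLpNorm_convolution_le (hψ n).continuous (b n).nonneg_normed (b n).integral_normed _).trans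
      (eLpNorm_fst_le w)
  have hdv2 : ∀ n, eLpNorm (fderiv ℝ (v n)) 2 volume ≤ N * ‖w‖ₑ := fun n =>
    (eLpNorm_fderiv_convolution_le w (hψ n) (hψc n) (b n).nonneg_normed
      (b n).integral_normed).trans ((Finset.sum_le_sum fun j _ => eLpNorm_snd_le w j).trans_eq
        (by simp))
  have hlim : ∀ᵐ x, Tendsto (fun n => v n x) atTop (𝓝 (w.val.fst x)) := by
    -- `K = 2` is the fixed ratio of outer to inner radius of the bumps. A bounded ratio is what
    -- a.e. convergence asks for.
    refine ContDiffBump.ae_convolution_tendsto_right_of_locallyIntegrable (K := 2) ?_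
      (Eventually.of_forall fun n => le_rfl) hloc
    change Tendsto (fun n : ℕ => 2 * (1 / ((n : ℝ) + 1))) atTop (𝓝 0)
    simpa using (tendsto_one_div_add_atTop_nhds_zero_nat (𝕜 := ℝ)).const_mul 2
  refine ⟨fun n x => χ n x * v n x, fun n => ((hχ n).of_le (by simp)).mul (hv n),
    fun n => (hχc n).mul_right, fun n => ?_, fun n => ?_, ?_⟩
  · refine (eLpNorm_mono_enorm fun x => ?_).trans ((hv2 n).trans ?_)
    · rw [enorm_mul]
      exact mul_le_of_le_one_left zero_le (hχ1 n x)
    · push_cast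
      rw [← enorm_eq_nnnorm, add_assoc, add_mul, one_mul]
      exact le_self_add
  · have hfd : ∀ x, fderiv ℝ (fun x => χ n x * v n x) x
        = χ n x • fderiv ℝ (v n) x + v n x • fderiv ℝ (χ n) x := fun x =>
      fderiv_fun_mul ((hχ n).differentiable (by simp) x) ((hv n).differentiable one_ne_zero x)
    have hfd' : fderiv ℝ (fun x => χ n x * v n x)
        = (fun x => χ n x • fderiv ℝ (v n) x) + fun x => v n x • fderiv ℝ (χ n) x := funext hfd
    rw [hfd']
    have hc1 : Continuous fun x => χ n x • fderiv ℝ (v n) x :=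
      (hχ n).continuous.smul ((hv n).continuous_fderiv one_ne_zero)
    have hc2 : Continuous fun x => v n x • fderiv ℝ (χ n) x :=
      (hv n).continuous.smul ((hχ n).continuous_fderiv (by simp))
    refine (eLpNorm_add_le hc1.aestronglyMeasurable hc2.aestronglyMeasurable (by norm_num)).trans ?_
    have h1 : eLpNorm (fun x => χ n x • fderiv ℝ (v n) x) 2 volume ≤ N * ‖w‖ₑ := by
      refine (eLpNorm_mono_enorm fun x => ?_).trans (hdv2 n)
      rw [enorm_smul]
      exact mul_le_of_le_one_left zero_le (hχ1 n x)
    have h2 : eLpNorm (fun x => v n x • fderiv ℝ (χ n) x) 2 volume ≤ D * ‖w‖ₑ := by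
      calc _ ≤ eLpNorm ((D : ℝ) • v n) 2 volume := by
            refine eLpNorm_mono_enorm fun x => ?_
            rw [enorm_smul, Pi.smul_apply, enorm_smul, mul_comm]
            gcongr
            simpa [Real.enorm_eq_ofReal] using hχD n x
        _ ≤ D * eLpNorm (v n) 2 volume := by
            refine eLpNorm_const_smul_le.trans_eq ?_
            rw [Real.enorm_eq_ofReal (by positivity), ENNReal.ofReal_coe_nnreal]
        _ ≤ _ := by
            gcongr
            exact hv2 n
    refine (add_le_add h1 h2).trans ?_
    push_cast
    rw [← enorm_eq_nnnorm, add_assoc, add_mul, ← add_mul]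
    exact le_add_self
  · filter_upwards [hlim] with x hx
    refine hx.congr' ?_
    filter_upwards [hχlim x] with n hn
    rw [hn, one_mul]

/-- The Sobolev embedding `H¹ ⊆ L^r`. -/
lemma HasTestEmbedding.exists_eLpNorm_fst_le {N : ℕ} {r : ℝ} (h : HasTestEmbedding N r) :
    ∃ C : ℝ≥0, ∀ w : sobolevH1 N, eLpNorm w.val.fst (ENNReal.ofReal r) volume ≤ C * ‖w‖ₑ := by
  obtain ⟨C, hC⟩ := h
  obtain ⟨K, hK⟩ := exists_testFunction_approx N
  refine ⟨C * K, fun w => ?_⟩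
  obtain ⟨f, hf, hfc, h2, hd2, hlim⟩ := hK w
  -- Fatou: the `L^r` norm is lower semicontinuous under a.e. convergence.
  refine Lp.eLpNorm_le_of_ae_tendsto (Eventually.of_forall fun n => ?_)
    (fun n => (hf n).continuous.aestronglyMeasurable) hlim
  refine (hC _ (hf n) (hfc n) _ (h2 n) (hd2 n)).trans_eq ?_
  push_cast
  rw [mul_assoc, ← enorm_eq_nnnorm]

end Embedding

/-! ### Pointwise estimates from the growth of the derivative. -/

section Growth

variable {V : Type*} [NormedAddCommGroup V] [NormedSpace ℝ V] {F : V → ℝ} {K : ℝ≥0} {r : ℝ}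

/-- Mean value inequality on the ball of radius `‖v‖ + ‖w‖` about `0`, which contains both points
and on which the growth bound is largest at the boundary radius. -/
lemma nnnorm_sub_le_of_growth (hF : Differentiable ℝ F) (hr : 2 ≤ r)
    (hK : ∀ v, ‖fderiv ℝ F v‖₊ ≤ K * (‖v‖₊ + ‖v‖₊ ^ (r - 1))) (v w : V) :
    ‖F (v + w) - F v‖₊
      ≤ K * ((‖v‖₊ + ‖w‖₊) + (‖v‖₊ + ‖w‖₊) ^ (r - 1)) * ‖w‖₊ := by
  have h := (convex_closedBall (0 : V) (‖v‖ + ‖w‖)).norm_image_sub_le_of_norm_fderiv_le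
    (𝕜 := ℝ) (f := F) (C := (K * ((‖v‖₊ + ‖w‖₊) + (‖v‖₊ + ‖w‖₊) ^ (r - 1)) : ℝ≥0))
    (x := v) (y := v + w) (fun z _ => hF z) (fun z hz => ?_) ?_ ?_
  · rw [add_sub_cancel_left] at h
    exact_mod_cast h
  · have hz' : ‖z‖₊ ≤ ‖v‖₊ + ‖w‖₊ := by
      have := mem_closedBall_zero_iff.1 hz
      exact_mod_cast this
    have h2 : ‖fderiv ℝ F z‖₊ ≤ K * ((‖v‖₊ + ‖w‖₊) + (‖v‖₊ + ‖w‖₊) ^ (r - 1)) := by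
      refine (hK z).trans ?_
      gcongr
      linarith
    exact_mod_cast h2
  · rw [mem_closedBall_zero_iff]
    linarith [norm_nonneg w]
  · rw [mem_closedBall_zero_iff]
    exact norm_add_le _ _

lemma enorm_le_of_growth (hF : Differentiable ℝ F) (hF0 : F 0 = 0) (hr : 2 ≤ r)
    (hK : ∀ v, ‖fderiv ℝ F v‖₊ ≤ K * (‖v‖₊ + ‖v‖₊ ^ (r - 1))) (v : V) :
    ‖F v‖ₑ ≤ K * (‖v‖ₑ ^ (2 : ℝ) + ‖v‖ₑ ^ r) := by
  have h := nnnorm_sub_le_of_growth hF hr hK 0 v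
  simp only [zero_add, hF0, sub_zero, nnnorm_zero] at h
  have h2 : ‖F v‖₊ ≤ K * (‖v‖₊ ^ (2 : ℝ) + ‖v‖₊ ^ r) := by
    refine h.trans_eq ?_
    rw [mul_assoc, add_mul, ← NNReal.rpow_add_one' (by linarith), sub_add_cancel, NNReal.rpow_two, sq]
  rw [enorm_eq_nnnorm, enorm_eq_nnnorm, ← ENNReal.coe_rpow_of_nonneg _ zero_le_two,
    ← ENNReal.coe_rpow_of_nonneg _ (by linarith)]
  exact_mod_cast h2

/-- The exponent `1` is kept as `2 - 1` so that Hölder's inequality in the form `|u|^(s-1)|h|`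
covers both terms, with `s = 2` and `s = r`. -/
lemma enorm_fderiv_apply_le_of_growth (hr : 2 ≤ r)
    (hK : ∀ v, ‖fderiv ℝ F v‖₊ ≤ K * (‖v‖₊ + ‖v‖₊ ^ (r - 1))) (v w : V) :
    ‖fderiv ℝ F v w‖ₑ ≤ K * (‖v‖ₑ ^ ((2 : ℝ) - 1) * ‖w‖ₑ + ‖v‖ₑ ^ (r - 1) * ‖w‖ₑ) := by
  rw [← add_mul, ← mul_assoc]
  refine (ContinuousLinearMap.le_opENorm _ _).trans ?_
  gcongr
  rw [enorm_eq_nnnorm, enorm_eq_nnnorm, ← ENNReal.coe_rpow_of_nonneg _ (by norm_num),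
    ← ENNReal.coe_rpow_of_nonneg _ (by linarith)]
  have := hK v
  norm_num
  exact_mod_cast this

/-- The bound on the first order Taylor remainder of a function of growth `r`. -/
lemma exists_enorm_remainder_le (hF : Differentiable ℝ F) (hr : 2 ≤ r)
    (hK : ∀ v, ‖fderiv ℝ F v‖₊ ≤ K * (‖v‖₊ + ‖v‖₊ ^ (r - 1))) :
    ∃ L : ℝ≥0, ∀ v w : V, ‖F (v + w) - F v - fderiv ℝ F v w‖ₑ
      ≤ (L * ‖v‖ₑ ^ ((2 : ℝ) - 1) + L * ‖v‖ₑ ^ (r - 1)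
        + L * (‖w‖ₑ ^ ((2 : ℝ) - 1) + ‖w‖ₑ ^ (r - 1))) * ‖w‖ₑ := by
  -- The increment and the linear term obey the same bound, hence `2`. The power `2^(r-2)` comes
  -- from convexity of `t^(r-1)`, and adding `1` gives a single constant for the linear and the
  -- power terms.
  refine ⟨2 * K * (1 + 2 ^ (r - 1 - 1)), fun v w => ?_⟩
  have h1 := nnnorm_sub_le_of_growth hF hr hK v w
  have h2 : ‖fderiv ℝ F v w‖₊ ≤ K * ((‖v‖₊ + ‖w‖₊) + (‖v‖₊ + ‖w‖₊) ^ (r - 1)) * ‖w‖₊ := by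
    refine ((fderiv ℝ F v).le_opNNNorm w).trans ?_
    gcongr
    refine (hK v).trans ?_
    gcongr <;> first | linarith | exact le_self_add
  have h3 : (‖v‖₊ + ‖w‖₊) ^ (r - 1) ≤ 2 ^ (r - 1 - 1) * (‖v‖₊ ^ (r - 1) + ‖w‖₊ ^ (r - 1)) :=
    NNReal.rpow_add_le_mul_rpow_add_rpow _ _ (by linarith)
  have h4 : ‖F (v + w) - F v - fderiv ℝ F v w‖₊
      ≤ (2 * K * (1 + 2 ^ (r - 1 - 1)) * ‖v‖₊ ^ ((2 : ℝ) - 1)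
        + 2 * K * (1 + 2 ^ (r - 1 - 1)) * ‖v‖₊ ^ (r - 1)
        + 2 * K * (1 + 2 ^ (r - 1 - 1)) * (‖w‖₊ ^ ((2 : ℝ) - 1) + ‖w‖₊ ^ (r - 1))) * ‖w‖₊ := by
    have e1 : ∀ a : ℝ≥0, a ^ ((2 : ℝ) - 1) = a := fun a => by norm_num
    rw [e1, e1]
    calc _ ≤ K * ((‖v‖₊ + ‖w‖₊) + (‖v‖₊ + ‖w‖₊) ^ (r - 1)) * ‖w‖₊
          + K * ((‖v‖₊ + ‖w‖₊) + (‖v‖₊ + ‖w‖₊) ^ (r - 1)) * ‖w‖₊ :=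
          (nnnorm_sub_le _ _).trans (add_le_add h1 h2)
      _ = 2 * K * ((‖v‖₊ + ‖w‖₊) + (‖v‖₊ + ‖w‖₊) ^ (r - 1)) * ‖w‖₊ := by ring
      _ ≤ 2 * K * ((1 + 2 ^ (r - 1 - 1)) * (‖v‖₊ + ‖w‖₊)
            + (1 + 2 ^ (r - 1 - 1)) * (‖v‖₊ ^ (r - 1) + ‖w‖₊ ^ (r - 1))) * ‖w‖₊ := by
          gcongr
          · exact le_mul_of_one_le_left zero_le le_self_add
          · refine h3.trans ?_
            gcongr
            exact le_add_self
      _ = _ := by ring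
  simp only [enorm_eq_nnnorm]
  rw [← ENNReal.coe_rpow_of_nonneg _ (by linarith), ← ENNReal.coe_rpow_of_nonneg _ (by linarith),
    ← ENNReal.coe_rpow_of_nonneg _ (by linarith), ← ENNReal.coe_rpow_of_nonneg _ (by linarith)]
  exact_mod_cast h4

/-- The quotient is taken in `ℝ≥0∞`, where `0 / 0 = 0`, so increments that vanish need no exclusion.
-/
lemma tendsto_enorm_remainder_div {v : V} (hF : DifferentiableAt ℝ F v) {ι : Type*} {l : Filter ι}
    {h : ι → V} (hh : Tendsto h l (𝓝 0)) :
    Tendsto (fun n => ‖F (v + h n) - F v - fderiv ℝ F v (h n)‖ₑ / ‖h n‖ₑ) l (𝓝 0) := by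
  have ho := hasFDerivAt_iff_isLittleO_nhds_zero.1 hF.hasFDerivAt
  rw [ENNReal.tendsto_nhds_zero]
  intro ε hε
  obtain ⟨δ, hδ0, hδ⟩ := ENNReal.lt_iff_exists_nnreal_btwn.1 hε
  have hδ0' : 0 < δ := by exact_mod_cast hδ0
  filter_upwards [hh.eventually (Asymptotics.isLittleO_iff.1 ho (c := δ) (by exact_mod_cast hδ0'))]
    with n hn
  refine (ENNReal.div_le_of_le_mul ?_).trans hδ.le
  rw [enorm_eq_nnnorm, enorm_eq_nnnorm]
  exact_mod_cast hn

end Growth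

/-! ### Hölder, dominated convergence and the integrated Taylor remainder. -/

section Integral

variable {α : Type*} [MeasurableSpace α] {μ : Measure α} {V : Type*} [NormedAddCommGroup V]

lemma eLpNorm_ofReal_eq {s : ℝ} (hs : 0 < s) (u : α → V) :
    eLpNorm u (ENNReal.ofReal s) μ = (∫⁻ x, ‖u x‖ₑ ^ s ∂μ) ^ (1 / s) := by
  rw [eLpNorm_eq_lintegral_rpow_enorm_toReal (by simpa using hs) (by simp),
    ENNReal.toReal_ofReal hs.le]

lemma eLpNorm_ofReal_rpow_eq {s : ℝ} (hs : 0 < s) (u : α → V) :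
    eLpNorm u (ENNReal.ofReal s) μ ^ s = ∫⁻ x, ‖u x‖ₑ ^ s ∂μ := by
  rw [eLpNorm_ofReal_eq hs, ← ENNReal.rpow_mul, one_div_mul_cancel hs.ne', ENNReal.rpow_one]

lemma enorm_rpow_sub_one_rpow_conjExponent {s : ℝ} (hs : 1 < s) (a : ℝ≥0∞) :
    (a ^ (s - 1)) ^ s.conjExponent = a ^ s := by
  rw [← ENNReal.rpow_mul]
  congr 1
  rw [Real.conjExponent]
  field_simp [(sub_pos.2 hs).ne']

lemma lintegral_enorm_rpow_mul_le {s : ℝ} (hs : 1 < s) {u h : α → V}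
    (hu : AEStronglyMeasurable u μ) (hh : AEStronglyMeasurable h μ) :
    ∫⁻ x, ‖u x‖ₑ ^ (s - 1) * ‖h x‖ₑ ∂μ
      ≤ eLpNorm u (ENNReal.ofReal s) μ ^ (s - 1) * eLpNorm h (ENNReal.ofReal s) μ := by
  have h0 : 0 < s := by linarith
  have := ENNReal.lintegral_mul_le_Lp_mul_Lq μ (Real.HolderConjugate.conjExponent hs).symm
    (f := fun x => ‖u x‖ₑ ^ (s - 1)) (g := fun x => ‖h x‖ₑ) (hu.enorm.pow_const _) hh.enorm
  simp only [enorm_rpow_sub_one_rpow_conjExponent hs, Pi.mul_apply] at this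
  rw [eLpNorm_ofReal_eq h0, eLpNorm_ofReal_eq h0, ← ENNReal.rpow_mul]
  refine this.trans_eq ?_
  congr 2
  rw [Real.conjExponent]
  field_simp

/-- Hölder's inequality combined with dominated convergence for the truncated factor. -/
lemma exists_tendsto_lintegral_min_mul_le {s : ℝ} (hs : 1 < s) {u : α → V}
    (hu : AEStronglyMeasurable u μ) (hus : eLpNorm u (ENNReal.ofReal s) μ ≠ ⊤)
    {ρ : ℕ → α → ℝ≥0∞} (hρm : ∀ n, AEMeasurable (ρ n) μ)
    (hρ : ∀ᵐ x ∂μ, Tendsto (fun n => ρ n x) atTop (𝓝 0))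
    {h : ℕ → α → V} (hh : ∀ n, AEStronglyMeasurable (h n) μ) (L : ℝ≥0) :
    ∃ ε : ℕ → ℝ≥0∞, Tendsto ε atTop (𝓝 0) ∧ ∀ n,
      ∫⁻ x, min (ρ n x) (L * ‖u x‖ₑ ^ (s - 1)) * ‖h n x‖ₑ ∂μ
        ≤ ε n * eLpNorm (h n) (ENNReal.ofReal s) μ := by
  have h0 : 0 < s := by linarith
  have hconj := (Real.HolderConjugate.conjExponent hs).symm
  set t := s.conjExponent with ht
  have ht0 : 0 < t := hconj.pos
  have hbm : AEMeasurable (fun x => (L : ℝ≥0∞) * ‖u x‖ₑ ^ (s - 1)) μ :=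
    (hu.enorm.pow_const _).const_mul _
  refine ⟨fun n => (∫⁻ x, min (ρ n x) (L * ‖u x‖ₑ ^ (s - 1)) ^ t ∂μ) ^ (1 / t), ?_, fun n => ?_⟩
  · have hlim : Tendsto (fun n => ∫⁻ x, min (ρ n x) (L * ‖u x‖ₑ ^ (s - 1)) ^ t ∂μ) atTop
        (𝓝 (∫⁻ _, 0 ∂μ)) := by
      -- With `t = s/(s-1)` the majorant is `L^t |u|^s`, integrable because `u ∈ L^s`; the
      -- truncation by `min` is what supplies it.
      refine tendsto_lintegral_of_dominated_convergence'
        (fun x => (L * ‖u x‖ₑ ^ (s - 1)) ^ t) (fun n => ((hρm n).min hbm).pow_const _)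
        (fun n => Eventually.of_forall fun x => ?_) ?_ ?_
      · exact ENNReal.rpow_le_rpow (min_le_right _ _) ht0.le
      · simp_rw [ENNReal.mul_rpow_of_nonneg _ _ ht0.le, ht,
          enorm_rpow_sub_one_rpow_conjExponent hs]
        rw [lintegral_const_mul' _ _ (by finiteness), ← eLpNorm_ofReal_rpow_eq h0]
        finiteness
      · filter_upwards [hρ] with x hx
        have h1 : Tendsto (fun n => min (ρ n x) (L * ‖u x‖ₑ ^ (s - 1))) atTop (𝓝 0) :=
          tendsto_of_tendsto_of_tendsto_of_le_of_le tendsto_const_nhds hx (fun _ => zero_le)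
            fun _ => min_le_left _ _
        simpa [ENNReal.zero_rpow_of_pos ht0] using h1.ennrpow_const t
    simpa [ENNReal.zero_rpow_of_pos (inv_pos.2 ht0)] using hlim.ennrpow_const (1 / t)
  · rw [eLpNorm_ofReal_eq h0]
    exact ENNReal.lintegral_mul_le_Lp_mul_Lq μ hconj ((hρm n).min hbm) (hh n).enorm

lemma aestronglyMeasurable_fderiv_apply [NormedSpace ℝ V] {F : V → ℝ} (hF : ContDiff ℝ 1 F)
    {u h : α → V} (hu : AEStronglyMeasurable u μ) (hh : AEStronglyMeasurable h μ) :
    AEStronglyMeasurable (fun x => fderiv ℝ F (u x) (h x)) μ :=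
  (((hF.continuous_fderiv one_ne_zero).comp continuous_fst).clm_apply
    continuous_snd).comp_aestronglyMeasurable (hu.prodMk hh)

/-- This separates the parts of the quotient dominated by powers of `u` alone, open to dominated
convergence, from the part controlled by the increment. -/
lemma le_min_add_min_add {ρ a b c : ℝ≥0∞} (h : ρ ≤ a + b + c) :
    ρ ≤ min ρ a + min ρ b + c := by
  rcases le_total ρ a with ha | ha
  · rw [min_eq_left ha, add_assoc]
    exact le_self_add
  rcases le_total ρ b with hb | hb
  · rw [min_eq_left hb, add_right_comm]
    exact le_add_self
  rwa [min_eq_right ha, min_eq_right hb]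

/-- The Taylor remainder of the Nemytski operator along a sequence of increments tending to zero
almost everywhere. -/
lemma exists_lintegral_remainder_le [NormedSpace ℝ V] {F : V → ℝ} {K : ℝ≥0} {r : ℝ}
    (hF : ContDiff ℝ 1 F) (hr : 2 ≤ r)
    (hK : ∀ v, ‖fderiv ℝ F v‖₊ ≤ K * (‖v‖₊ + ‖v‖₊ ^ (r - 1)))
    {u : α → V} (hu : AEStronglyMeasurable u μ) (hu2 : eLpNorm u 2 μ ≠ ⊤)
    (hur : eLpNorm u (ENNReal.ofReal r) μ ≠ ⊤)
    {h : ℕ → α → V} (hh : ∀ n, AEStronglyMeasurable (h n) μ)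
    (hh0 : ∀ᵐ x ∂μ, Tendsto (fun n => h n x) atTop (𝓝 0)) :
    ∃ (ε : ℕ → ℝ≥0∞) (L : ℝ≥0), Tendsto ε atTop (𝓝 0) ∧ ∀ n,
      ∫⁻ x, ‖F (u x + h n x) - F (u x) - fderiv ℝ F (u x) (h n x)‖ₑ ∂μ
        ≤ ε n * (eLpNorm (h n) 2 μ + eLpNorm (h n) (ENNReal.ofReal r) μ)
          + L * (eLpNorm (h n) 2 μ ^ (2 : ℝ) + eLpNorm (h n) (ENNReal.ofReal r) μ ^ r) := by
  have hFd : Differentiable ℝ F := hF.differentiable one_ne_zero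
  obtain ⟨L, hL⟩ := exists_enorm_remainder_le hFd hr hK
  have hrem : ∀ n, AEStronglyMeasurable
      (fun x => F (u x + h n x) - F (u x) - fderiv ℝ F (u x) (h n x)) μ := fun n =>
    ((hF.continuous.comp_aestronglyMeasurable (hu.add (hh n))).sub
      (hF.continuous.comp_aestronglyMeasurable hu)).sub
      (aestronglyMeasurable_fderiv_apply hF hu (hh n))
  let ρ : ℕ → α → ℝ≥0∞ := fun n x =>
    ‖F (u x + h n x) - F (u x) - fderiv ℝ F (u x) (h n x)‖ₑ / ‖h n x‖ₑ
  have hρm : ∀ n, AEMeasurable (ρ n) μ := fun n => (hrem n).enorm.div (hh n).enorm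
  have hρ : ∀ᵐ x ∂μ, Tendsto (fun n => ρ n x) atTop (𝓝 0) := by
    filter_upwards [hh0] with x hx
    exact tendsto_enorm_remainder_div (hFd (u x)) hx
  have h2 : ENNReal.ofReal 2 = 2 := by simp
  obtain ⟨ε₁, hε₁, hb₁⟩ := exists_tendsto_lintegral_min_mul_le (s := 2) one_lt_two hu
    (by rwa [h2]) hρm hρ hh L
  obtain ⟨ε₂, hε₂, hb₂⟩ := exists_tendsto_lintegral_min_mul_le (s := r) (by linarith) hu
    hur hρm hρ hh L
  refine ⟨fun n => ε₁ n + ε₂ n, L, by simpa using hε₁.add hε₂, fun n => ?_⟩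
  have hpt : ∀ x, ‖F (u x + h n x) - F (u x) - fderiv ℝ F (u x) (h n x)‖ₑ
      ≤ min (ρ n x) (L * ‖u x‖ₑ ^ ((2 : ℝ) - 1)) * ‖h n x‖ₑ
        + min (ρ n x) (L * ‖u x‖ₑ ^ (r - 1)) * ‖h n x‖ₑ
        + L * (‖h n x‖ₑ ^ (2 : ℝ) + ‖h n x‖ₑ ^ r) := by
    intro x
    rcases eq_or_ne (h n x) 0 with h0 | h0
    · simp [h0]
    have hne : ‖h n x‖ₑ ≠ 0 := by simpa using h0
    have hpow : ∀ s : ℝ, 2 ≤ s → ‖h n x‖ₑ ^ s = ‖h n x‖ₑ ^ (s - 1) * ‖h n x‖ₑ := fun s hs => by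
      conv_rhs => rw [← ENNReal.rpow_one ‖h n x‖ₑ, ← ENNReal.rpow_mul, one_mul]
      rw [← ENNReal.rpow_add_of_nonneg _ _ (by linarith) zero_le_one, sub_add_cancel]
    have hle : ρ n x ≤ L * ‖u x‖ₑ ^ ((2 : ℝ) - 1) + L * ‖u x‖ₑ ^ (r - 1)
        + L * (‖h n x‖ₑ ^ ((2 : ℝ) - 1) + ‖h n x‖ₑ ^ (r - 1)) :=
      ENNReal.div_le_of_le_mul (hL _ _)
    calc _ = ρ n x * ‖h n x‖ₑ := (ENNReal.div_mul_cancel hne (by simp)).symm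
      _ ≤ _ := mul_le_mul_left (le_min_add_min_add hle) _
      _ = _ := by
        rw [hpow 2 le_rfl, hpow r hr]
        ring
  have hm : ∀ s : ℝ, AEMeasurable (fun x => min (ρ n x) (L * ‖u x‖ₑ ^ s) * ‖h n x‖ₑ) μ :=
    fun s => ((hρm n).min ((hu.enorm.pow_const _).const_mul _)).mul (hh n).enorm
  refine (lintegral_mono hpt).trans ?_
  have hm₁₂ : AEMeasurable (fun x => min (ρ n x) (L * ‖u x‖ₑ ^ ((2 : ℝ) - 1)) * ‖h n x‖ₑ
      + min (ρ n x) (L * ‖u x‖ₑ ^ (r - 1)) * ‖h n x‖ₑ) μ := (hm _).add (hm _)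
  rw [lintegral_add_left' hm₁₂, lintegral_add_left' (hm _),
    lintegral_const_mul' _ _ (by simp), lintegral_add_left' ((hh n).enorm.pow_const _)]
  have hb₁' := hb₁ n
  rw [h2] at hb₁'
  rw [← eLpNorm_ofReal_rpow_eq (by linarith : 0 < r), ← eLpNorm_ofReal_rpow_eq two_pos, h2]
  gcongr
  calc _ ≤ ε₁ n * eLpNorm (h n) 2 μ + ε₂ n * eLpNorm (h n) (ENNReal.ofReal r) μ :=
        add_le_add hb₁' (hb₂ n)
    _ ≤ (ε₁ n + ε₂ n) * eLpNorm (h n) 2 μ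
        + (ε₁ n + ε₂ n) * eLpNorm (h n) (ENNReal.ofReal r) μ := by
        gcongr
        · exact le_self_add
        · exact le_add_self
    _ = _ := (mul_add _ _ _).symm

end Integral

/-! ### Differentiability along subsequences. -/

/-- A sequential criterion for Fréchet differentiability. -/
lemma hasFDerivAt_of_seq {E G : Type*} [SeminormedAddCommGroup E] [NormedSpace ℝ E]
    [SeminormedAddCommGroup G] [NormedSpace ℝ G] {f : E → G} {D : E →L[ℝ] G} {u : E}
    (h : ∀ η : ℕ → E, Tendsto (fun n => ‖η n‖ₑ) atTop (𝓝 0) → ∃ (ms : ℕ → ℕ) (δ : ℕ → ℝ≥0∞),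
      Tendsto δ atTop (𝓝 0) ∧
        ∀ n, ‖f (u + η (ms n)) - f u - D (η (ms n))‖ₑ ≤ δ n * ‖η (ms n)‖ₑ) :
    HasFDerivAt f D u := by
  have key : Tendsto (fun e => ‖f (u + e) - f u - D e‖ₑ / ‖e‖ₑ) (𝓝 0) (𝓝 0) := by
    -- A limit exists once every sequence has a subsequence with that limit, so `h` may discard
    -- terms; this permits passing to a.e. convergence later.
    refine tendsto_of_subseq_tendsto fun η hη => ?_
    obtain ⟨ms, δ, hδ, hle⟩ := h η (by
      simpa [Function.comp_def, enorm_eq_nnnorm] using (continuous_enorm.tendsto (0 : E)).comp hη)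
    exact ⟨ms, tendsto_of_tendsto_of_tendsto_of_le_of_le tendsto_const_nhds hδ (fun _ => zero_le)
      fun n => ENNReal.div_le_of_le_mul (hle n)⟩
  have ho : (fun e => f (u + e) - f u - D e) =o[𝓝 0] fun e => e := by
    refine Asymptotics.isLittleO_iff.2 fun c hc => ?_
    filter_upwards [ENNReal.tendsto_nhds_zero.1 key (ENNReal.ofReal c) (by simpa using hc)]
      with e he
    rw [ENNReal.div_le_iff_le_mul (Or.inr (by simp)) (Or.inl (by simp)), ← ofReal_norm,
      ← ofReal_norm, ← ENNReal.ofReal_mul hc.le] at he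
    exact (ENNReal.ofReal_le_ofReal_iff (by positivity)).1 he
  have ht : Tendsto (fun x => x - u) (𝓝 u) (𝓝 0) := by
    simpa using (tendsto_id (x := 𝓝 u)).sub_const u
  refine HasFDerivAt.of_isLittleO ((ho.comp_tendsto ht).congr_left fun x => ?_)
  simp

/-! ### Vector-valued `H¹` functions and the Nemytski operator. -/

variable {N k : ℕ}

namespace H1

lemma aestronglyMeasurable_toFun (u : H1 N k) : AEStronglyMeasurable u.toFun volume := by
  have h : AEMeasurable (fun x (i : Fin k) => u.comp i x) (volume : Measure (Eucl N)) :=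
    aemeasurable_pi_lambda _ fun i => (Lp.aestronglyMeasurable (u.comp i)).aemeasurable
  exact ((PiLp.continuous_toLp 2 _).measurable.comp_aemeasurable h).aestronglyMeasurable

lemma toFun_add (u v : H1 N k) : (u + v).toFun =ᵐ[volume] fun x => u.toFun x + v.toFun x := by
  have h : ∀ i, (u + v).comp i =ᵐ[volume] u.comp i + v.comp i := fun i =>
    Lp.coeFn_add (u.comp i) (v.comp i)
  filter_upwards [ae_all_iff.2 h] with x hx
  ext i
  exact hx i

lemma toFun_smul (c : ℝ) (u : H1 N k) : (c • u).toFun =ᵐ[volume] fun x => c • u.toFun x := by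
  have h : ∀ i, (c • u).comp i =ᵐ[volume] c • u.comp i := fun i => Lp.coeFn_smul c (u.comp i)
  filter_upwards [ae_all_iff.2 h] with x hx
  ext i
  exact hx i

/-- From `|u| ≤ ∑ |u_i|` and the triangle inequality; the factor `k` counts components. -/
lemma eLpNorm_toFun_le {s : ℝ≥0∞} (hs : 1 ≤ s) {C : ℝ≥0}
    (hC : ∀ w : sobolevH1 N, eLpNorm w.val.fst s volume ≤ C * ‖w‖ₑ) (u : H1 N k) :
    eLpNorm u.toFun s volume ≤ (k * C : ℝ≥0) * ‖u‖ₑ := by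
  calc eLpNorm u.toFun s volume ≤ eLpNorm (∑ i, fun x => ‖u.comp i x‖) s volume := by
        refine eLpNorm_mono_real fun x => ?_
        rw [Finset.sum_apply]
        have h : u.toFun x = ∑ i, u.comp i x • EuclideanSpace.single i (1 : ℝ) := by
          conv_lhs => rw [← (EuclideanSpace.basisFun (Fin k) ℝ).sum_repr (u.toFun x)]
          simp [H1.toFun]
        rw [h]
        refine (norm_sum_le _ _).trans (Finset.sum_le_sum fun i _ => ?_)
        simp [norm_smul]
    _ ≤ ∑ i, eLpNorm (fun x => ‖u.comp i x‖) s volume :=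
        eLpNorm_sum_le (fun i _ => (Lp.aestronglyMeasurable (u.comp i)).norm) hs
    _ ≤ ∑ _i : Fin k, C * ‖u‖ₑ := by
        refine Finset.sum_le_sum fun i _ => ?_
        rw [eLpNorm_norm]
        refine (hC (u i)).trans ?_
        gcongr
        rw [← ofReal_norm, ← ofReal_norm]
        exact ENNReal.ofReal_le_ofReal (PiLp.norm_apply_le u i)
    _ = _ := by
        rw [Finset.sum_const, Finset.card_univ, Fintype.card_fin, nsmul_eq_mul]
        push_cast
        ring

end H1

section Nemytski

variable {F : Eucl k → ℝ} {K C : ℝ≥0} {r : ℝ}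

lemma integrable_comp_toFun (hF : ContDiff ℝ 1 F) (hF0 : F 0 = 0) (hr : 2 ≤ r)
    (hK : ∀ v, ‖fderiv ℝ F v‖₊ ≤ K * (‖v‖₊ + ‖v‖₊ ^ (r - 1)))
    (h2 : ∀ u : H1 N k, eLpNorm u.toFun 2 volume ≤ C * ‖u‖ₑ)
    (hCr : ∀ u : H1 N k, eLpNorm u.toFun (ENNReal.ofReal r) volume ≤ C * ‖u‖ₑ) (u : H1 N k) :
    Integrable (fun x => F (u.toFun x)) volume := by
  refine ⟨hF.continuous.comp_aestronglyMeasurable u.aestronglyMeasurable_toFun, ?_⟩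
  have hm := u.aestronglyMeasurable_toFun.enorm
  have hlt : ∀ s, eLpNorm u.toFun s volume ≤ C * ‖u‖ₑ → eLpNorm u.toFun s volume ≠ ⊤ :=
    fun s hs => ne_top_of_le_ne_top (by finiteness) hs
  calc ∫⁻ x, ‖F (u.toFun x)‖ₑ
      ≤ ∫⁻ x, K * (‖u.toFun x‖ₑ ^ (2 : ℝ) + ‖u.toFun x‖ₑ ^ r) :=
        lintegral_mono fun x => enorm_le_of_growth (hF.differentiable one_ne_zero) hF0 hr hK _
    _ = K * (eLpNorm u.toFun 2 volume ^ (2 : ℝ)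
          + eLpNorm u.toFun (ENNReal.ofReal r) volume ^ r) := by
        rw [lintegral_const_mul' _ _ (by simp), lintegral_add_left' (hm.pow_const _),
          ← eLpNorm_ofReal_rpow_eq (by linarith : 0 < r), ← eLpNorm_ofReal_rpow_eq two_pos,
          ENNReal.ofReal_ofNat]
    _ < ⊤ := by
        have := hlt _ (h2 u)
        have := hlt _ (hCr u)
        refine ENNReal.mul_lt_top (by simp) (ENNReal.add_lt_top.2 ⟨?_, ?_⟩)
        · finiteness
        · exact ENNReal.rpow_lt_top_of_nonneg (by linarith) this

/-- Hölder with `s = 2` and `s = r`. The constant depends on `u` but not on `h`, which makes the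
candidate derivative bounded from `H¹` to `L¹`. -/
lemma lintegral_fderiv_toFun_le (hr : 2 ≤ r)
    (hK : ∀ v, ‖fderiv ℝ F v‖₊ ≤ K * (‖v‖₊ + ‖v‖₊ ^ (r - 1)))
    (h2 : ∀ u : H1 N k, eLpNorm u.toFun 2 volume ≤ C * ‖u‖ₑ)
    (hCr : ∀ u : H1 N k, eLpNorm u.toFun (ENNReal.ofReal r) volume ≤ C * ‖u‖ₑ) (u : H1 N k) :
    ∃ B : ℝ≥0, ∀ h : H1 N k, ∫⁻ x, ‖fderiv ℝ F (u.toFun x) (h.toFun x)‖ₑ ≤ B * ‖h‖ₑ := by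
  have hfin : (K : ℝ≥0∞) * ((C * ‖u‖ₑ) ^ ((2 : ℝ) - 1) * C + (C * ‖u‖ₑ) ^ (r - 1) * C) ≠ ⊤ := by
    have h1 : (C * ‖u‖ₑ) ^ ((2 : ℝ) - 1) ≠ ⊤ :=
      ENNReal.rpow_ne_top_of_nonneg (by linarith) (by finiteness)
    have h2 : (C * ‖u‖ₑ) ^ (r - 1) ≠ ⊤ :=
      ENNReal.rpow_ne_top_of_nonneg (by linarith) (by finiteness)
    finiteness
  refine ⟨(K * ((C * ‖u‖ₑ) ^ ((2 : ℝ) - 1) * C + (C * ‖u‖ₑ) ^ (r - 1) * C) : ℝ≥0∞).toNNReal,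
    fun h => ?_⟩
  rw [ENNReal.coe_toNNReal hfin]
  have hu := u.aestronglyMeasurable_toFun
  have hh := h.aestronglyMeasurable_toFun
  have hH2 := lintegral_enorm_rpow_mul_le (μ := volume) (s := 2) one_lt_two hu hh
  have hHr := lintegral_enorm_rpow_mul_le (μ := volume) (s := r) (by linarith) hu hh
  rw [ENNReal.ofReal_ofNat] at hH2
  calc ∫⁻ x, ‖fderiv ℝ F (u.toFun x) (h.toFun x)‖ₑ
      ≤ ∫⁻ x, K * (‖u.toFun x‖ₑ ^ ((2 : ℝ) - 1) * ‖h.toFun x‖ₑ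
          + ‖u.toFun x‖ₑ ^ (r - 1) * ‖h.toFun x‖ₑ) :=
        lintegral_mono fun x => enorm_fderiv_apply_le_of_growth hr hK _ _
    _ = K * ((∫⁻ x, ‖u.toFun x‖ₑ ^ ((2 : ℝ) - 1) * ‖h.toFun x‖ₑ)
          + ∫⁻ x, ‖u.toFun x‖ₑ ^ (r - 1) * ‖h.toFun x‖ₑ) := by
        have hm : AEMeasurable (fun x => ‖u.toFun x‖ₑ ^ ((2 : ℝ) - 1) * ‖h.toFun x‖ₑ) volume :=
          (hu.enorm.pow_const _).mul hh.enorm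
        rw [lintegral_const_mul' _ _ (by simp), lintegral_add_left' hm]
    _ ≤ K * ((C * ‖u‖ₑ) ^ ((2 : ℝ) - 1) * (C * ‖h‖ₑ) + (C * ‖u‖ₑ) ^ (r - 1) * (C * ‖h‖ₑ)) := by
        gcongr
        · refine hH2.trans (mul_le_mul' (ENNReal.rpow_le_rpow (h2 u) (by linarith)) (h2 h))
        · refine hHr.trans (mul_le_mul' (ENNReal.rpow_le_rpow (hCr u) (by linarith)) (hCr h))
    _ = _ := by ring

/-- The derivative `h ↦ F'(u) h` of the Nemytski operator, as a bounded operator `H¹ → L¹`. -/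
lemma exists_nemytski_fderiv (hF : ContDiff ℝ 1 F) (hr : 2 ≤ r)
    (hK : ∀ v, ‖fderiv ℝ F v‖₊ ≤ K * (‖v‖₊ + ‖v‖₊ ^ (r - 1)))
    (h2 : ∀ u : H1 N k, eLpNorm u.toFun 2 volume ≤ C * ‖u‖ₑ)
    (hCr : ∀ u : H1 N k, eLpNorm u.toFun (ENNReal.ofReal r) volume ≤ C * ‖u‖ₑ) (u : H1 N k) :
    ∃ D : H1 N k →L[ℝ] Lp ℝ 1 (volume : Measure (Eucl N)), ∀ h : H1 N k,
      D h =ᵐ[volume] fun x => fderiv ℝ F (u.toFun x) (h.toFun x) := by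
  obtain ⟨B, hB⟩ := lintegral_fderiv_toFun_le hr hK h2 hCr u
  have hi : ∀ h : H1 N k, Integrable (fun x => fderiv ℝ F (u.toFun x) (h.toFun x)) volume :=
    fun h => ⟨aestronglyMeasurable_fderiv_apply hF u.aestronglyMeasurable_toFun
      h.aestronglyMeasurable_toFun, (hB h).trans_lt (by finiteness)⟩
  let D₀ : H1 N k →ₗ[ℝ] Lp ℝ 1 (volume : Measure (Eucl N)) :=
    { toFun := fun h => (hi h).toL1 _
      map_add' := fun h h' => by
        rw [← Integrable.toL1_add, Integrable.toL1_eq_toL1_iff]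
        filter_upwards [h.toFun_add h'] with x hx
        rw [hx, map_add]
        rfl
      map_smul' := fun c h => by
        rw [RingHom.id_apply, ← Integrable.toL1_smul, Integrable.toL1_eq_toL1_iff]
        filter_upwards [h.toFun_smul c] with x hx
        rw [hx, map_smul] }
  refine ⟨D₀.mkContinuous B fun h => ?_, fun h => (hi h).coeFn_toL1⟩
  have h1 : ‖D₀ h‖ₑ ≤ B * ‖h‖ₑ := (Integrable.enorm_toL1 (hi h)).trans_le (hB h)
  rw [enorm_eq_nnnorm, enorm_eq_nnnorm] at h1
  exact_mod_cast h1

lemma differentiable_nemytski (hF : ContDiff ℝ 1 F) (hr : 2 < r)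
    (hK : ∀ v, ‖fderiv ℝ F v‖₊ ≤ K * (‖v‖₊ + ‖v‖₊ ^ (r - 1)))
    (h2 : ∀ u : H1 N k, eLpNorm u.toFun 2 volume ≤ C * ‖u‖ₑ)
    (hCr : ∀ u : H1 N k, eLpNorm u.toFun (ENNReal.ofReal r) volume ≤ C * ‖u‖ₑ)
    (hint : ∀ u : H1 N k, Integrable (fun x => F (u.toFun x)) volume) :
    Differentiable ℝ (nemytski F hint) := by
  intro u
  obtain ⟨D, hD⟩ := exists_nemytski_fderiv hF hr.le hK h2 hCr u
  refine HasFDerivAt.differentiableAt (f' := D) (hasFDerivAt_of_seq fun η hηe => ?_)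
  have hu := u.aestronglyMeasurable_toFun
  have hne : ∀ s, eLpNorm u.toFun s volume ≤ C * ‖u‖ₑ → eLpNorm u.toFun s volume ≠ ⊤ :=
    fun s hs => ne_top_of_le_ne_top (by finiteness) hs
  have hrem : ∀ h : H1 N k, ‖nemytski F hint (u + h) - nemytski F hint u - D h‖ₑ
      = ∫⁻ x, ‖F (u.toFun x + h.toFun x) - F (u.toFun x)
        - fderiv ℝ F (u.toFun x) (h.toFun x)‖ₑ := by
    intro h
    rw [Lp.enorm_def, eLpNorm_one_eq_lintegral_enorm]
    refine lintegral_congr_ae ?_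
    filter_upwards [Lp.coeFn_sub (nemytski F hint (u + h) - nemytski F hint u) (D h),
      Lp.coeFn_sub (nemytski F hint (u + h)) (nemytski F hint u), hD h,
      (hint (u + h)).coeFn_toL1, (hint u).coeFn_toL1, u.toFun_add h] with x h1 h2 h3 h4 h5 h6
    rw [h1, Pi.sub_apply, h2, Pi.sub_apply, h3]
    unfold nemytski
    rw [h4, h5, h6]
  have hL2 : Tendsto (fun n => eLpNorm ((η n).toFun - 0) 2 volume) atTop (𝓝 0) := by
    have h3 : Tendsto (fun n => (C : ℝ≥0∞) * ‖η n‖ₑ) atTop (𝓝 0) := by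
      simpa using ENNReal.Tendsto.const_mul hηe (Or.inr (ENNReal.coe_ne_top (r := C)))
    exact tendsto_of_tendsto_of_tendsto_of_le_of_le tendsto_const_nhds h3 (fun _ => zero_le)
      fun n => by simpa using h2 (η n)
  -- Convergence in `L²` implies convergence in measure, hence a.e. along a subsequence.
  obtain ⟨ms, hms, hae⟩ := (tendstoInMeasure_of_tendsto_eLpNorm two_ne_zero
    (fun n => (η n).aestronglyMeasurable_toFun) aestronglyMeasurable_zero hL2).exists_seq_tendsto_ae
  obtain ⟨ε, L, hε, hle⟩ := exists_lintegral_remainder_le hF hr.le hK hu (hne _ (h2 u))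
    (hne _ (hCr u)) (h := fun n => (η (ms n)).toFun)
    (fun n => (η (ms n)).aestronglyMeasurable_toFun) hae
  -- This is the remainder bound divided by `‖η (ms n)‖`: `2 * C` collects the `L²` and `L^r` norms,
  -- and the leftover exponents `2 - 1` and `r - 1` are positive.
  refine ⟨ms, fun n => ε n * (2 * C) + L * (C ^ (2 : ℝ) * ‖η (ms n)‖ₑ ^ ((2 : ℝ) - 1)
    + C ^ r * ‖η (ms n)‖ₑ ^ (r - 1)), ?_, fun n => ?_⟩
  · have hηms : Tendsto (fun n => ‖η (ms n)‖ₑ) atTop (𝓝 0) := hηe.comp hms.tendsto_atTop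
    have hpow : ∀ s : ℝ, 0 < s → Tendsto (fun n => (C : ℝ≥0∞) ^ (s + 1) * ‖η (ms n)‖ₑ ^ s) atTop
        (𝓝 0) := fun s hs => by
      have h3 := hηms.ennrpow_const s
      rw [ENNReal.zero_rpow_of_pos hs] at h3
      simpa using ENNReal.Tendsto.const_mul h3
        (Or.inr (ENNReal.rpow_ne_top_of_nonneg (by linarith) (ENNReal.coe_ne_top (r := C))))
    have h4 := hpow (2 - 1) (by norm_num)
    have h5 := hpow (r - 1) (by linarith)
    rw [sub_add_cancel] at h4 h5
    have h6 := ENNReal.Tendsto.const_mul (h4.add h5) (Or.inr (ENNReal.coe_ne_top (r := L)))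
    have h7 := ENNReal.Tendsto.mul_const hε
      (Or.inr (by finiteness : (2 * C : ℝ≥0∞) ≠ ⊤))
    simpa using h7.add h6
  · rw [hrem]
    have hb2 := h2 (η (ms n))
    have hbr := hCr (η (ms n))
    have hpow : ∀ s : ℝ, 2 ≤ s → (C * ‖η (ms n)‖ₑ) ^ s
        = C ^ s * ‖η (ms n)‖ₑ ^ (s - 1) * ‖η (ms n)‖ₑ := fun s hs => by
      rw [ENNReal.mul_rpow_of_nonneg _ _ (by linarith), mul_assoc]
      congr 1
      conv_rhs => rw [← ENNReal.rpow_one ‖η (ms n)‖ₑ, ← ENNReal.rpow_mul, one_mul]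
      rw [← ENNReal.rpow_add_of_nonneg _ _ (by linarith) zero_le_one, sub_add_cancel]
    calc _ ≤ _ := hle n
      _ ≤ ε n * (C * ‖η (ms n)‖ₑ + C * ‖η (ms n)‖ₑ)
          + L * ((C * ‖η (ms n)‖ₑ) ^ (2 : ℝ) + (C * ‖η (ms n)‖ₑ) ^ r) := by
        gcongr
      _ = _ := by
        rw [hpow 2 le_rfl, hpow r hr.le]
        ring

end Nemytski

/-! ### The energy functional. -/

lemma differentiable_add_sum_norm_sq {E G X Y : Type*} [NormedAddCommGroup E] [NormedSpace ℝ E]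
    [NormedAddCommGroup G] [NormedSpace ℝ G] [NormedAddCommGroup X] [InnerProductSpace ℝ X]
    [NormedAddCommGroup Y] [InnerProductSpace ℝ Y] {T : E → G} (hT : Differentiable ℝ T)
    (J : G →L[ℝ] ℝ) (A : Fin k → E →L[ℝ] X) (B : Fin k → E →L[ℝ] Y) :
    Differentiable ℝ fun z : E × Eucl k => J (T z.1) + 1 / 2 * ∑ i, ‖A i z.1‖ ^ 2
      + 1 / 2 * ∑ i, z.2 i ^ 2 * ‖B i z.1‖ ^ 2 := by
  have hω : ∀ i, Differentiable ℝ fun z : E × Eucl k => z.2 i := fun i =>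
    ((EuclideanSpace.proj i : Eucl k →L[ℝ] ℝ).comp
      (ContinuousLinearMap.snd ℝ E (Eucl k))).differentiable
  have hA : ∀ i, Differentiable ℝ fun z : E × Eucl k => ‖A i z.1‖ ^ 2 := fun i =>
    ((A i).differentiable.comp differentiable_fst).norm_sq ℝ
  have hB : ∀ i, Differentiable ℝ fun z : E × Eucl k => ‖B i z.1‖ ^ 2 := fun i =>
    ((B i).differentiable.comp differentiable_fst).norm_sq ℝ
  exact ((J.differentiable.comp (hT.comp differentiable_fst)).add
    ((Differentiable.fun_sum fun i _ => hA i).const_mul _)).add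
    ((Differentiable.fun_sum fun i _ => ((hω i).pow 2).mul (hB i)).const_mul _)

/-- The normed group structure on `H¹`, with the seminorm of `PiLp` unfolding reducibly. -/
abbrev H1.normedAddCommGroup : NormedAddCommGroup (H1 N k) :=
  .ofSeparation fun _ h => norm_eq_zero.1 h

/-- Integration is a bounded functional on `L¹`, and `u ↦ u_i`, `u ↦ ∇u_i` are bounded linear maps
into Hilbert spaces. -/
lemma differentiable_energy {F : Eucl k → ℝ}
    (hint : ∀ u : H1 N k, Integrable (fun x => F (u.toFun x)) volume)
    (hd : Differentiable ℝ (nemytski F hint)) : Differentiable ℝ (energy (N := N) F) := by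
  have hI : ∀ u : H1 N k, ∫ x, F (u.toFun x) = L1.integralCLM (nemytski F hint u) := by
    intro u
    rw [← L1.integral_eq, nemytski, ← integral_eq]
  let P : Fin k → H1 N k →L[ℝ] WithLp 2 (L2 N × PiLp 2 (fun _ : Fin N => L2 N)) := fun i =>
    (sobolevH1 N).subtypeL ∘L PiLp.proj 2 _ i
  have h := @differentiable_add_sum_norm_sq k (H1 N k) _ _ _ H1.normedAddCommGroup
    (PiLp.normedSpace 2 ℝ _) _ _ _ _ _ _ (nemytski F hint) hd L1.integralCLM
    (fun i => (WithLp.sndL 2 ℝ (L2 N) (PiLp 2 (fun _ : Fin N => L2 N))).comp (P i))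
    (fun i => (WithLp.fstL 2 ℝ (L2 N) (PiLp 2 (fun _ : Fin N => L2 N))).comp (P i))
  have hE : energy (N := N) F = fun z => L1.integralCLM (nemytski F hint z.1)
      + 1 / 2 * ∑ i, ‖z.1.grad i‖ ^ 2 + 1 / 2 * ∑ i, z.2 i ^ 2 * ‖z.1.comp i‖ ^ 2 := by
    ext z
    rw [energy, hI]
  rw [hE]
  exact h

/-! ### Reduction of the hypotheses on `R` to a single growth exponent. -/

lemma rpow_le_self_add_rpow {t a b : ℝ} (ht : 0 ≤ t) (ha : 1 ≤ a) (hab : a ≤ b) :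
    t ^ a ≤ t + t ^ b := by
  rcases le_total t 1 with h | h
  · have := Real.rpow_le_rpow_of_exponent_ge_of_imp ht h ha (by intros; linarith)
    rw [Real.rpow_one] at this
    linarith [Real.rpow_nonneg ht b]
  · linarith [Real.rpow_le_rpow_of_exponent_le h hab]

/-- A quadratic form plus a remainder of growth between `2` and `r` has growth `r`. -/
lemma exists_nnnorm_fderiv_le {F R : Eucl k → ℝ} {m : Fin k → ℝ} (hF : ContDiff ℝ 1 F)
    (hFR : ∀ v, F v = 1 / 2 * ∑ i, m i ^ 2 * |v i| ^ 2 + R v) {p q r c c' : ℝ} (hc : 0 ≤ c)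
    (hc' : 0 ≤ c') (hp : 2 < p) (hpq : p ≤ q) (hqr : q ≤ r)
    (hgrowth : ∀ v, ‖gradient R v‖ ≤ c * ‖v‖ ^ (p - 1) + c' * ‖v‖ ^ (q - 1)) :
    ∃ K : ℝ≥0, ∀ v, ‖fderiv ℝ F v‖₊ ≤ K * (‖v‖₊ + ‖v‖₊ ^ (r - 1)) := by
  let pr : Fin k → Eucl k →L[ℝ] ℝ := fun i => EuclideanSpace.proj i
  have hQ : ∀ v : Eucl k, HasFDerivAt (fun v : Eucl k => 1 / 2 * ∑ i, m i ^ 2 * |v i| ^ 2)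
      (∑ i, (m i ^ 2 * v i) • pr i) v := by
    intro v
    have h := (HasFDerivAt.fun_sum (u := Finset.univ) fun i _ =>
      (((pr i).hasFDerivAt (x := v)).pow 2).const_mul (m i ^ 2)).const_mul (1 / 2 : ℝ)
    refine (h.congr_fderiv ?_).congr_of_eventuallyEq (Eventually.of_forall fun w => ?_)
    · ext w
      simp [Finset.mul_sum, pr]
      refine Finset.sum_congr rfl fun i _ => ?_
      ring
    · simp [pr]
  -- Differentiability of `R` is inherited from `F` and the quadratic form. Without it `gradient R
  -- v` could be the default value `0`, and the growth hypothesis would say nothing there.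
  have hRd : ∀ v, DifferentiableAt ℝ R v := fun v => by
    have h : R = fun v => F v - 1 / 2 * ∑ i, m i ^ 2 * |v i| ^ 2 := by
      ext v
      rw [hFR v]
      ring
    rw [h]
    exact (hF.differentiable one_ne_zero v).sub (hQ v).differentiableAt
  have hfd : ∀ v, fderiv ℝ F v = (∑ i, (m i ^ 2 * v i) • pr i) + fderiv ℝ R v := fun v => by
    have h : F = fun v => 1 / 2 * ∑ i, m i ^ 2 * |v i| ^ 2 + R v := funext hFR
    rw [h]
    exact ((hQ v).add (hRd v).hasFDerivAt).fderiv
  have hpr : ∀ i, ‖pr i‖ ≤ 1 := fun i =>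
    (pr i).opNorm_le_bound zero_le_one fun v => by
      rw [one_mul]
      exact PiLp.norm_apply_le v i
  have hQn : ∀ v : Eucl k, ‖∑ i, (m i ^ 2 * v i) • pr i‖ ≤ (∑ i, m i ^ 2) * ‖v‖ := fun v => by
    rw [Finset.sum_mul]
    refine (norm_sum_le _ _).trans (Finset.sum_le_sum fun i _ => ?_)
    rw [norm_smul, norm_mul, Real.norm_of_nonneg (sq_nonneg (m i)), mul_assoc]
    gcongr
    exact (mul_le_of_le_one_right (norm_nonneg _) (hpr i)).trans (PiLp.norm_apply_le v i)
  refine ⟨⟨(∑ i, m i ^ 2) + c + c', by positivity⟩, fun v => ?_⟩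
  have hRn : ‖fderiv ℝ R v‖ = ‖gradient R v‖ := by simp [gradient]
  have hv := norm_nonneg v
  have h1 := rpow_le_self_add_rpow hv (by linarith : 1 ≤ p - 1) (by linarith : p - 1 ≤ r - 1)
  have h2 := rpow_le_self_add_rpow hv (by linarith : 1 ≤ q - 1) (by linarith : q - 1 ≤ r - 1)
  have hS : 0 ≤ ∑ i, m i ^ 2 := by positivity
  have h3 := Real.rpow_nonneg hv (r - 1)
  have key : ‖fderiv ℝ F v‖ ≤ ((∑ i, m i ^ 2) + c + c') * (‖v‖ + ‖v‖ ^ (r - 1)) := by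
    rw [hfd]
    refine (norm_add_le _ _).trans ?_
    rw [hRn]
    linarith [hQn v, hgrowth v, mul_le_mul_of_nonneg_left h1 hc,
      mul_le_mul_of_nonneg_left h2 hc', mul_nonneg hS h3]
  exact_mod_cast key

end EllipticSystem

end

theorem mainTheorem4 (N k : ℕ) (hN : 1 ≤ N) (hk : 1 ≤ k)
    (F R : EllipticSystem.Eucl k → ℝ) (m : Fin k → ℝ) (hm : ∀ i, 0 < m i)
    (hF : ContDiff ℝ 1 F)
    (hFR : ∀ v, F v = 1 / 2 * ∑ i, m i ^ 2 * |v i| ^ 2 + R v)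
    (hR0 : R 0 = 0)
    (p q c c' : ℝ) (hc : 0 ≤ c) (hc' : 0 ≤ c')
    (hp : 2 < p) (hpq : p ≤ q) (hq : (q : EReal) < EllipticSystem.criticalExponent N)
    (hgrowth : ∀ v, ‖gradient R v‖ ≤ c * ‖v‖ ^ (p - 1) + c' * ‖v‖ ^ (q - 1)) :
    (∃ hint : ∀ u : EllipticSystem.H1 N k, Integrable (fun x => F (u.toFun x)) volume,
      Continuous (EllipticSystem.nemytski F hint) ∧
      Differentiable ℝ (EllipticSystem.nemytski F hint)) ∧
    Differentiable ℝ (EllipticSystem.energy (N := N) F) := by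
  obtain ⟨r, hqr, hr⟩ := EllipticSystem.exists_hasTestEmbedding hN hq
  have hr2 : 2 < r := by linarith
  obtain ⟨K, hK⟩ := EllipticSystem.exists_nnnorm_fderiv_le hF hFR hc hc' hp hpq hqr hgrowth
  have hF0 : F 0 = 0 := by simp [hFR, hR0]
  obtain ⟨C₁, hC₁⟩ := hr.exists_eLpNorm_fst_le
  -- One constant for both embeddings: `k * 1` for `L²` and `k * C₁` for `L^r`.
  obtain ⟨C, hC, hC'⟩ : ∃ C : NNReal, k * 1 ≤ C ∧ k * C₁ ≤ C :=
    ⟨_, le_max_left _ _, le_max_right _ _⟩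
  have h2 : ∀ u : EllipticSystem.H1 N k, eLpNorm u.toFun 2 volume ≤ C * ‖u‖ₑ := fun u =>
    (EllipticSystem.H1.eLpNorm_toFun_le (C := 1) (by norm_num)
      (fun w => by simpa using EllipticSystem.eLpNorm_fst_le w) u).trans
      (mul_le_mul_left (by exact_mod_cast hC) _)
  have hCr : ∀ u : EllipticSystem.H1 N k,
      eLpNorm u.toFun (ENNReal.ofReal r) volume ≤ C * ‖u‖ₑ := fun u =>
    (EllipticSystem.H1.eLpNorm_toFun_le (by rw [ENNReal.one_le_ofReal]; linarith) hC₁ u).trans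
      (mul_le_mul_left (by exact_mod_cast hC') _)
  have hint := EllipticSystem.integrable_comp_toFun hF hF0 hr2.le hK h2 hCr
  have hd := EllipticSystem.differentiable_nemytski hF hr2 hK h2 hCr hint
  exact ⟨⟨hint, hd.continuous, hd⟩, EllipticSystem.differentiable_energy hint hd⟩
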